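/- Let $G$ be a connected simple graph (finite or infinite) with at least three vertices, with graph metric $d$, and for vertices $x,y$ let $I(x,y)=\{z: d(x,y)=d(x,z)+d(z,y)\}$. $G$ is a \emph{median graph} if $I(x,y)\cap I(y,z)\cap I(z,x)$ is a singleton for all vertices $x,y,z$. $G$ is a \emph{partial double tree} if it has an isometric embedding into the Cartesian product $T_1\,\Box\,T_2$ of two (possibly infinite) trees; such an embedding is \emph{minimal} if both its projections to $T_1$ and $T_2$ are onto. A \emph{convex split} of $G$ is a partition $\{A,B\}$ of the vertex set into two nonempty sets such that $I(x,y)$ is contained in $A$ (respectively $B$) for all $x,y$ in $A$ (respectively $B$); the graph $\mathrm{Inc}(G)$ has the convex splits of $G$ as vertices, with $\{A_1,B_1\}$ and $\{A_2,B_2\}$ adjacent when all of $A_1\cap A_2$, $A_1\cap B_2$, $B_1\cap A_2$, $B_1\cap B_2$ are nonempty. For a vertex $x$, the graph $\mathrm{Link}(x)$ has the edges of $G$ incident with $x$ as vertices, two distinct ones being adjacent when they lie in a common induced 4-cycle of $G$; the graph $\mathrm{Link}(G)$, whose vertices are the edges of $G$, is the union of the graphs $\mathrm{Link}(x)$ over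 all vertices $x$. Then the following conditions are equivalent: (i) $G$ is a partial double tree, and its minimal isometric embedding into a product of two trees is unique up to interchanging the two factors and isomorphisms of the trees; that is, for any two minimal isometric embeddings $f:G\to T_1\,\Box\,T_2$ and $g:G\to S_1\,\Box\,S_2$, either $g=(\alpha\times\beta)\circ f$ for some isomorphisms $\alpha:T_1\to S_1$, $\beta:T_2\to S_2$, or the same holds after the two factors $S_1,S_2$ are interchanged; (ii) $G$ is 2-connected (connected after the removal of any one vertex) and is a median subgraph, i.e. an isometric subgraph that is a median graph, of the Cartesian product of two trees; (iii) $G$ is a median graph and $\mathrm{Inc}(G)$ is bipartite and connected; (iv) $G$ is a median graph and $\mathrm{Link}(x)$ is bipartite and connected for every vertex $x$ of $G$; (v) $G$ is a median graph and $\mathrm{Link}(G)$ is bipartite and connected. -/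

import Mathlib

open SimpleGraph

namespace PartialDoubleTree

universe u v

section Metric

variable {V : Type u} (G : SimpleGraph V)

/-- The interval `I(x, y)`: all vertices on shortest paths between `x` and `y`. -/
def interval (x y : V) : Set V := {z | G.dist x y = G.dist x z + G.dist z y}

/-- The set `m(x, y, z)` of medians of a triple. -/
def medians (x y z : V) : Set V := interval G x y ∩ interval G y z ∩ interval G z x

/-- Median graphs: connected graphs in which every triple has exactly one median. -/
def IsMedian : Prop := G.Connected ∧ ∀ x y z : V, ∃! m : V, m ∈ medians G x y z

/-- (Interval-)convex sets of vertices. -/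
def IsConvex (A : Set V) : Prop := ∀ x ∈ A, ∀ y ∈ A, interval G x y ⊆ A

/-- A convex split: an unordered pair `{H, Hᶜ}` of complementary nonempty convex sets. -/
def IsConvexSplit (s : Set (Set V)) : Prop :=
  ∃ H : Set V, H.Nonempty ∧ Hᶜ.Nonempty ∧ IsConvex G H ∧ IsConvex G Hᶜ ∧ s = {H, Hᶜ}

/-- The incompatibility graph `Inc(G)`: its vertices are the convex splits, and two splits are
adjacent when every side of the one meets every side of the other. -/
def Inc : SimpleGraph {s : Set (Set V) // IsConvexSplit G s} where
  Adj s t := ∀ A ∈ s.1, ∀ B ∈ t.1, (A ∩ B).Nonempty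
  symm := ⟨fun s t h B hB A hA => by
    rw [Set.inter_comm]
    exact h A hA B hB⟩
  loopless := ⟨fun s h => by
    obtain ⟨s, H, _, _, _, _, rfl⟩ := s
    simpa using h H (by simp) Hᶜ (by simp)⟩

end Metric

section Links

variable {V : Type u} (G : SimpleGraph V)

/-- `x, y, w, z` are, in this cyclic order, the vertices of an induced 4-cycle, that is, of a
2-cell of the cube complex `|G|`. -/
def IsSquare (x y w z : V) : Prop :=
  G.Adj x y ∧ G.Adj y w ∧ G.Adj w z ∧ G.Adj z x ∧ x ≠ w ∧ y ≠ z ∧ ¬ G.Adj x w ∧ ¬ G.Adj y z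

theorem IsSquare.flip {x y w z : V} (h : IsSquare G x y w z) : IsSquare G x z w y := by
  obtain ⟨h1, h2, h3, h4, h5, h6, h7, h8⟩ := h
  exact ⟨h4.symm, h3.symm, h2.symm, h1.symm, h5, h6.symm, h7, fun h => h8 h.symm⟩

/-- The link of a vertex `x`: its vertices are the edges of `G` at `x`, two of them (`xy` and
`xz`) being adjacent when they lie in a common square `x, y, w, z`. -/
def Link (x : V) : SimpleGraph (G.incidenceSet x) where
  Adj e f := ∃ y w z : V, IsSquare G x y w z ∧ e.1 = s(x, y) ∧ f.1 = s(x, z)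
  symm := ⟨fun _ _ ⟨y, w, z, h, he, hf⟩ => ⟨z, w, y, h.flip, hf, he⟩⟩
  loopless := ⟨fun _ ⟨_, _, _, h, he, hf⟩ => h.2.2.2.2.2.1 (Sym2.congr_right.mp (he.symm.trans hf))⟩

/-- The link graph `Link(G)`: the union of the links of all vertices, as a graph whose vertices
are the edges of `G`. -/
def LinkGraph : SimpleGraph G.edgeSet where
  Adj e f := ∃ (x : V) (he : e.1 ∈ G.incidenceSet x) (hf : f.1 ∈ G.incidenceSet x),
    (Link G x).Adj ⟨e.1, he⟩ ⟨f.1, hf⟩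
  symm := ⟨fun _ _ ⟨x, he, hf, h⟩ => ⟨x, hf, he, h.symm⟩⟩
  loopless := ⟨fun _ ⟨_, _, _, h⟩ => h.ne rfl⟩

/-- 2-connected graphs: at least three vertices, connected, and without cut vertices. -/
def IsTwoConnected : Prop :=
  3 ≤ ENat.card V ∧ G.Connected ∧ ∀ x : V, (G.induce {x}ᶜ).Connected

end Links

section Embeddings

/-- Isometric embeddings of (connected) graphs with respect to the graph metric. -/
def IsIsometricEmbedding {V : Type u} {W : Type v} (G : SimpleGraph V) (H : SimpleGraph W)
    (f : V → W) : Prop := ∀ x y : V, H.dist (f x) (f y) = G.dist x y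

/-- Partial double trees: connected graphs that embed isometrically into the Cartesian product
of two (possibly infinite) trees. -/
def IsPartialDoubleTree {V : Type u} (G : SimpleGraph V) : Prop :=
  G.Connected ∧ ∃ (W₁ W₂ : Type u) (T₁ : SimpleGraph W₁) (T₂ : SimpleGraph W₂) (f : V → W₁ × W₂),
    T₁.IsTree ∧ T₂.IsTree ∧ IsIsometricEmbedding G (T₁ □ T₂) f

/-- `G` is (isomorphic to) a median subgraph of the Cartesian product of two trees, i.e. an
isometric subgraph that is a median graph. -/
def IsMedianSubgraphOfTwoTrees {V : Type u} (G : SimpleGraph V) : Prop :=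
  IsMedian G ∧ ∃ (W₁ W₂ : Type u) (T₁ : SimpleGraph W₁) (T₂ : SimpleGraph W₂) (f : V → W₁ × W₂),
    T₁.IsTree ∧ T₂.IsTree ∧ IsIsometricEmbedding G (T₁ □ T₂) f

/-- A minimal isometric embedding into the product of two trees: both projections are onto. -/
def IsMinimalEmbedding {V W₁ W₂ : Type u} (G : SimpleGraph V) (T₁ : SimpleGraph W₁)
    (T₂ : SimpleGraph W₂) (f : V → W₁ × W₂) : Prop :=
  T₁.IsTree ∧ T₂.IsTree ∧ IsIsometricEmbedding G (T₁ □ T₂) f ∧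
    Function.Surjective (fun v => (f v).1) ∧ Function.Surjective (fun v => (f v).2)

/-- Two maps into products of two trees agree up to isomorphisms of the trees and a possible
interchange of the two factors. -/
def AreEquivalent {V W₁ W₂ W₁' W₂' : Type u} (T₁ : SimpleGraph W₁) (T₂ : SimpleGraph W₂)
    (S₁ : SimpleGraph W₁') (S₂ : SimpleGraph W₂') (f : V → W₁ × W₂) (g : V → W₁' × W₂') : Prop :=
  (∃ (α : T₁ ≃g S₁) (β : T₂ ≃g S₂), ∀ v, g v = (α (f v).1, β (f v).2)) ∨
    (∃ (α : T₁ ≃g S₂) (β : T₂ ≃g S₁), ∀ v, g v = (β (f v).2, α (f v).1))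

/-- Up to minimality, interchange of the trees and isomorphisms of the trees, there is at most
one isometric embedding of `G` into the product of two trees. -/
def HasUniqueEmbedding {V : Type u} (G : SimpleGraph V) : Prop :=
  ∀ (W₁ W₂ W₁' W₂' : Type u) (T₁ : SimpleGraph W₁) (T₂ : SimpleGraph W₂)
    (S₁ : SimpleGraph W₁') (S₂ : SimpleGraph W₂') (f : V → W₁ × W₂) (g : V → W₁' × W₂'),
    IsMinimalEmbedding G T₁ T₂ f → IsMinimalEmbedding G S₁ S₂ g →
      AreEquivalent T₁ T₂ S₁ S₂ f g

end Embeddings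

end PartialDoubleTree

/-! Everything is read off from edge colorings. In an isometric embedding into a product of two
trees each edge moves exactly one coordinate, and consecutive sides of a square move different ones,
so the embedding gives a proper 2-coloring of `LinkGraph G` (`IsTreePair.isSquareColoring`).
Conversely, contracting either color class of such a coloring of a median graph yields a tree, and
the two contractions form an isometric embedding (`isTreePair_colorClass`). A minimal embedding is
determined by its coloring (`areEquivalent_of_left_eq_iff`). As partial double trees are median
(`IsTreePair.isMedian`), existence says that `LinkGraph G` is bipartite, and uniqueness that it has
only one 2-coloring up to complement, i.e. is connected.

`Inc G` is compared with `LinkGraph G` by sending an edge to the split between its ends. This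
preserves adjacency, its fibers are joined by ladders of squares (`IsMedian.ladder_induction`), and
adjacent splits lift to adjacent edges (`exists_linkGraph_adj`); so bipartiteness and connectedness
transfer both ways.

Locally, 2-colorings of the single links disagree along edges by a mod 2 cocycle, which is a
coboundary (`IsMedian.exists_coboundary`); flipping some links makes them agree. A link is connected
exactly when its vertex is not a cut vertex: geodesics from `x` to the two ends of an edge avoiding
`x` start in the same component of the link (`IsMedian.exists_linkComponent`). -/

namespace PartialDoubleTree

universe u v

/-! ### Intervals and geodesics in connected graphs. -/

section Basics

variable {V : Type u} {G : SimpleGraph V}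

theorem mem_interval {x y z : V} :
    z ∈ interval G x y ↔ G.dist x y = G.dist x z + G.dist z y := Iff.rfl

theorem mem_interval_symm {x y z : V} (h : z ∈ interval G x y) : z ∈ interval G y x := by
  rw [mem_interval] at *
  rw [G.dist_comm (u := y) (v := x), G.dist_comm (u := y) (v := z), G.dist_comm (u := z) (v := x)]
  omega

theorem dist_le_succ_of_adj (hG : G.Connected) {u v : V} (x : V) (h : G.Adj u v) :
    G.dist x v ≤ G.dist x u + 1 := by
  have h1 := hG.dist_triangle (u := x) (v := u) (w := v)
  rwa [dist_eq_one_iff_adj.2 h] at h1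

theorem exists_adj_dist_eq (hG : G.Connected) {x y : V} {n : ℕ} (h : G.dist x y = n + 1) :
    ∃ z, G.Adj z y ∧ G.dist x z = n := by
  obtain ⟨p, hp⟩ := hG.exists_walk_length_eq_dist y x
  rw [G.dist_comm, h] at hp
  cases p with
  | nil => simp at hp
  | cons h' q =>
    rename_i z
    refine ⟨z, h'.symm, ?_⟩
    have h1 := dist_le q
    rw [Walk.length_cons] at hp
    have h2 := dist_le_succ_of_adj hG x h'.symm
    rw [G.dist_comm] at h1
    omega

/-- A map to `ℕ` that moves by at most one along edges takes every intermediate value on every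
interval. -/
theorem exists_mem_interval_eq (hG : G.Connected) (φ : V → ℕ)
    (hφ : ∀ u v, G.Adj u v → φ v ≤ φ u + 1) (x : V) (k : ℕ) (hx : φ x ≤ k) (y : V)
    (hy : k ≤ φ y) : ∃ z ∈ interval G x y, φ z = k := by
  induction hn : G.dist x y generalizing y with
  | zero =>
    obtain rfl := hG.dist_eq_zero_iff.1 hn
    exact ⟨x, by simp [mem_interval], by omega⟩
  | succ n ih =>
    rcases hy.eq_or_lt with hy | hy
    · exact ⟨y, by simp [mem_interval], hy.symm⟩
    obtain ⟨y', hadj, hd⟩ := exists_adj_dist_eq hG hn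
    have h1 := hφ y' y hadj
    obtain ⟨z, hz, hk⟩ := ih y' (by omega) hd
    refine ⟨z, ?_, hk⟩
    rw [mem_interval] at *
    have h2 := dist_le_succ_of_adj hG z hadj
    have h3 := hG.dist_triangle (u := x) (v := z) (w := y)
    omega

theorem exists_mem_interval_dist_eq (hG : G.Connected) {x y : V} {k : ℕ} (hk : k ≤ G.dist x y) :
    ∃ z ∈ interval G x y, G.dist x z = k :=
  exists_mem_interval_eq hG (G.dist x) (fun _ _ h => dist_le_succ_of_adj hG x h) x k
    (by simp) y hk

theorem dist_eq_two (hG : G.Connected) {x y w : V} (h1 : G.Adj x w) (h2 : G.Adj w y) (hne : x ≠ y)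
    (hadj : ¬ G.Adj x y) : G.dist x y = 2 := by
  have := hG.one_lt_dist_of_ne_of_not_adj hne hadj
  have h3 := dist_le_succ_of_adj hG x h2
  rw [dist_eq_one_iff_adj.2 h1] at h3
  omega

end Basics

/-! ### Intervals and medians in trees. -/

section Trees

variable {W : Type v} {T : SimpleGraph W}

/-- Geodesics from `x` to `a` and `a'`, prolonged to `b`, are both paths, and a tree has only one.
-/
theorem eq_of_adj_of_dist_eq (hT : T.IsTree) {x a a' b : W} (h : T.Adj a b) (h' : T.Adj a' b)
    (hd : T.dist x b = T.dist x a + 1) (hd' : T.dist x b = T.dist x a' + 1) : a = a' := by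
  obtain ⟨p, hp⟩ := hT.connected.exists_walk_length_eq_dist x a
  obtain ⟨q, hq⟩ := hT.connected.exists_walk_length_eq_dist x a'
  have hp' : (p.concat h).IsPath := Walk.isPath_of_length_eq_dist _ (by simp [hp, hd])
  have hq' : (q.concat h').IsPath := Walk.isPath_of_length_eq_dist _ (by simp [hq, hd'])
  have := hT.existsUnique_path x b |>.unique hp' hq'
  simpa using congrArg Walk.penultimate this

theorem dist_eq_add_one_of_adj (hT : T.IsTree) (x : W) {a b : W} (h : T.Adj a b) :
    T.dist x a = T.dist x b + 1 ∨ T.dist x b = T.dist x a + 1 :=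
  hT.dist_eq_dist_add_one_of_adj x h

/-- In a tree a point of an interval is determined by its distance to one end. -/
theorem eq_of_mem_interval (hT : T.IsTree) {x y m m' : W} (hm : m ∈ interval T x y)
    (hm' : m' ∈ interval T x y) (h : T.dist x m = T.dist x m') : m = m' := by
  have hc := hT.connected
  rw [mem_interval] at hm hm'
  induction hn : T.dist y m generalizing m m' with
  | zero =>
    obtain rfl := hc.dist_eq_zero_iff.1 hn
    rw [T.dist_self] at hm
    exact (hc.dist_eq_zero_iff.1 (by omega)).symm
  | succ n ih =>
    have hn' : T.dist y m' = n + 1 := by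
      rw [T.dist_comm] at hn ⊢
      omega
    obtain ⟨a, ha, hda⟩ := exists_adj_dist_eq hc hn
    obtain ⟨a', ha', hda'⟩ := exists_adj_dist_eq hc hn'
    have e1 := dist_le_succ_of_adj hc x ha.symm
    have e2 := dist_le_succ_of_adj hc x ha'.symm
    have e3 := hc.dist_triangle (u := x) (v := a) (w := y)
    have e4 := hc.dist_triangle (u := x) (v := a') (w := y)
    have e5 := T.dist_comm (u := y) (v := a)
    have e6 := T.dist_comm (u := y) (v := a')
    have e7 := T.dist_comm (u := y) (v := m)
    have e8 := T.dist_comm (u := y) (v := m')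
    obtain rfl := ih (m := a) (m' := a') (by omega) (by omega) (by omega) hda
    exact eq_of_adj_of_dist_eq hT ha.symm ha'.symm (x := x) (by omega) (by omega)

/-- An interval of a tree is a single geodesic, hence a chain ordered by distance from `x`. -/
theorem mem_interval_or_mem_interval (hT : T.IsTree) {x y z m : W} (hz : z ∈ interval T x y)
    (hm : m ∈ interval T x y) : z ∈ interval T x m ∨ z ∈ interval T m y := by
  have hc := hT.connected
  have key : ∀ {a b c : W}, a ∈ interval T x y → b ∈ interval T x y → T.dist x a ≤ T.dist x b →
      a ∈ interval T x b := by
    intro a b _ ha hb h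
    obtain ⟨a', ha', hd⟩ := exists_mem_interval_dist_eq hc h
    have : a' ∈ interval T x y := by
      rw [mem_interval] at *
      have e1 := hc.dist_triangle (u := x) (v := a') (w := y)
      have e2 := hc.dist_triangle (u := a') (v := b) (w := y)
      omega
    rwa [eq_of_mem_interval hT ha this hd.symm]
  rcases le_total (T.dist x z) (T.dist x m) with h | h
  · exact Or.inl (key (c := x) hz hm h)
  · have := key (c := x) hm hz h
    right
    rw [mem_interval] at *
    omega

theorem mem_interval_of_between (hT : T.Connected) {x y m s t : W} (hm : m ∈ interval T x y)
    (hs : s ∈ interval T x m) (ht : t ∈ interval T m y) : m ∈ interval T s t := by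
  rw [mem_interval] at *
  have e1 := hT.dist_triangle (u := x) (v := s) (w := y)
  have e2 := hT.dist_triangle (u := s) (v := t) (w := y)
  have e3 := hT.dist_triangle (u := s) (v := m) (w := t)
  omega

/-- Trees are modular: every triple has a median. -/
theorem exists_median_of_isTree (hT : T.IsTree) (x y z : W) : ∃ m, m ∈ medians T x y z := by
  classical
  have hc := hT.connected
  -- The median is the point of `I(y, z)` nearest to `x`.
  have hex : ∃ n, ∃ m ∈ interval T y z, T.dist x m = n :=
    ⟨_, y, by simp [mem_interval], rfl⟩
  obtain ⟨m, hm, hd⟩ := Nat.find_spec hex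
  have hmin : ∀ a ∈ interval T y z, T.dist x m ≤ T.dist x a := fun a ha =>
    hd ▸ Nat.find_min' hex ⟨a, ha, rfl⟩
  clear hd
  have key : ∀ {y z : W}, m ∈ interval T y z → (∀ a ∈ interval T y z, T.dist x m ≤ T.dist x a) →
      m ∈ interval T x z := by
    intro y z hm hmin
    -- Walking from `m` towards `z` leads away from `x`: at the first step by minimality of `m`;
    -- later, a step towards `x` would have to return to the preceding vertex.
    have : ∀ n b, b ∈ interval T m z → T.dist m b = n →
        T.dist x b = T.dist x m + n ∧ ∀ a, T.Adj a b → T.dist m b = T.dist m a + 1 →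
          T.dist x b = T.dist x a + 1 := by
      intro n
      induction n with
      | zero =>
        intro b _ hb
        obtain rfl := hc.dist_eq_zero_iff.1 hb
        simp
      | succ n ih =>
        intro b hbz hb
        obtain ⟨a, hab, hda⟩ := exists_adj_dist_eq hc hb
        have haz : a ∈ interval T m z := by
          rw [mem_interval] at *
          have e1 := hc.dist_triangle (u := m) (v := a) (w := z)
          have e2 := dist_le_succ_of_adj hc z hab.symm
          rw [T.dist_comm, T.dist_comm (u := z) (v := b)] at e2
          omega
        obtain ⟨h1, h2⟩ := ih a haz hda
        have h3 : T.dist x b = T.dist x a + 1 := by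
          refine (dist_eq_add_one_of_adj hT x hab).resolve_left fun h => ?_
          cases n with
          | zero =>
            obtain rfl := hc.dist_eq_zero_iff.1 hda
            have := hmin b (by
              rw [mem_interval] at *
              have e1 := hc.dist_triangle (u := y) (v := b) (w := z)
              have e2 := dist_le_succ_of_adj hc y hab
              omega)
            omega
          | succ k =>
            obtain ⟨a', haa, hda'⟩ := exists_adj_dist_eq hc hda
            have h4 := h2 a' haa (by omega)
            have := eq_of_adj_of_dist_eq hT haa hab.symm h4 h
            subst this
            omega
        refine ⟨by omega, fun a' ha' hd' => ?_⟩
        rwa [← eq_of_adj_of_dist_eq hT hab ha' (x := m) (by omega) hd']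
    rw [mem_interval]
    exact (this _ z (by simp [mem_interval]) rfl).1
  refine ⟨m, ⟨mem_interval_symm (key (mem_interval_symm hm) fun a ha =>
    hmin a (mem_interval_symm ha)) |> mem_interval_symm, hm⟩, mem_interval_symm (key hm hmin)⟩

/-- The three pairwise distances determine the distance from `x` to a median. -/
theorem eq_of_mem_medians (hT : T.IsTree) {x y z m m' : W} (hm : m ∈ medians T x y z)
    (hm' : m' ∈ medians T x y z) : m = m' := by
  obtain ⟨⟨h1, h2⟩, h3⟩ := hm
  obtain ⟨⟨h1', h2'⟩, h3'⟩ := hm'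
  refine eq_of_mem_interval hT h1 h1' ?_
  rw [mem_interval] at *
  have e1 := T.dist_comm (u := m) (v := y)
  have e2 := T.dist_comm (u := m) (v := z)
  have e3 := T.dist_comm (u := m) (v := x)
  have e4 := T.dist_comm (u := m') (v := y)
  have e5 := T.dist_comm (u := m') (v := z)
  have e6 := T.dist_comm (u := m') (v := x)
  omega

end Trees

/-! ### Isometric subgraphs of a product of two trees are median. -/

section DoubleTrees

variable {V W₁ W₂ : Type*} {G : SimpleGraph V} {T₁ : SimpleGraph W₁} {T₂ : SimpleGraph W₂}

theorem dist_boxProd (h₁ : T₁.Connected) (h₂ : T₂.Connected) (a b : W₁ × W₂) :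
    (T₁ □ T₂).dist a b = T₁.dist a.1 b.1 + T₂.dist a.2 b.2 := by
  have h := edist_boxProd (G := T₁) (H := T₂) a b
  rw [← (h₁.boxProd h₂ a b).coe_dist_eq_edist, ← (h₁ a.1 b.1).coe_dist_eq_edist,
    ← (h₂ a.2 b.2).coe_dist_eq_edist] at h
  exact_mod_cast h

/-- `p` and `q` are the coordinate maps of an isometric embedding into the product of two trees. -/
structure IsTreePair (G : SimpleGraph V) (T₁ : SimpleGraph W₁) (T₂ : SimpleGraph W₂) (p : V → W₁)
    (q : V → W₂) : Prop where
  tree_left : T₁.IsTree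
  tree_right : T₂.IsTree
  dist_eq : ∀ x y, G.dist x y = T₁.dist (p x) (p y) + T₂.dist (q x) (q y)

namespace IsTreePair

variable {p : V → W₁} {q : V → W₂}

theorem swap (h : IsTreePair G T₁ T₂ p q) : IsTreePair G T₂ T₁ q p :=
  ⟨h.tree_right, h.tree_left, fun x y => by rw [h.dist_eq, add_comm]⟩

/-- Triangle inequalities in the two factors add up to an equality, so both are equalities. -/
theorem mem_interval_left (h : IsTreePair G T₁ T₂ p q) {x y z : V} (hz : z ∈ interval G x y) :
    p z ∈ interval T₁ (p x) (p y) := by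
  rw [mem_interval] at *
  simp only [h.dist_eq] at hz
  have e1 := h.tree_left.connected.dist_triangle (u := p x) (v := p z) (w := p y)
  have e2 := h.tree_right.connected.dist_triangle (u := q x) (v := q z) (w := q y)
  omega

theorem dist_left_le (h : IsTreePair G T₁ T₂ p q) (a : W₁) {u v : V}
    (huv : G.Adj u v) : T₁.dist a (p v) ≤ T₁.dist a (p u) + 1 := by
  have e1 := h.tree_left.connected.dist_triangle (u := a) (v := p u) (w := p v)
  have e2 := h.dist_eq u v
  rw [dist_eq_one_iff_adj.2 huv] at e2
  omega

theorem exists_left_eq (h : IsTreePair G T₁ T₂ p q) (hG : G.Connected) {x y : V} {m : W₁}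
    (hm : m ∈ interval T₁ (p x) (p y)) : ∃ z ∈ interval G x y, p z = m := by
  obtain ⟨z, hz, hd⟩ := exists_mem_interval_eq hG (fun v => T₁.dist (p x) (p v))
    (fun u v huv => h.dist_left_le _ huv) x (T₁.dist (p x) m) (by simp) y
    (by rw [mem_interval] at hm; omega)
  exact ⟨z, hz, eq_of_mem_interval h.tree_left (h.mem_interval_left hz) hm hd⟩

theorem ext (h : IsTreePair G T₁ T₂ p q) (hG : G.Connected) {x y : V} (hp : p x = p y)
    (hq : q x = q y) : x = y := by
  rw [← hG.dist_eq_zero_iff, h.dist_eq, hp, hq]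
  simp

/-- A connected graph that embeds isometrically into a product of two trees is median. -/
theorem isMedian (h : IsTreePair G T₁ T₂ p q) (hG : G.Connected) : IsMedian G := by
  refine ⟨hG, fun x y z => ?_⟩
  obtain ⟨m₁, ⟨h1, h2⟩, h3⟩ := exists_median_of_isTree h.tree_left (p x) (p y) (p z)
  obtain ⟨m₂, ⟨k1, k2⟩, k3⟩ := exists_median_of_isTree h.tree_right (q x) (q y) (q z)
  obtain ⟨r, hr, hr'⟩ := h.exists_left_eq hG h1
  obtain ⟨s, hs, hs'⟩ := h.exists_left_eq hG h2
  obtain ⟨t, ht, ht'⟩ := h.exists_left_eq hG h3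
  -- A geodesic between two vertices over `m₁` stays over `m₁`, while its second coordinate sweeps
  -- out a whole interval.
  have key : ∀ {u v : V}, p u = m₁ → p v = m₁ → m₂ ∈ interval T₂ (q u) (q v) →
      ∃ m, p m = m₁ ∧ q m = m₂ := by
    intro u v hu hv hm
    obtain ⟨m, hm, hm'⟩ := h.swap.exists_left_eq hG hm
    refine ⟨m, ?_, hm'⟩
    have := h.mem_interval_left hm
    rw [hu, hv, mem_interval, T₁.dist_self] at this
    exact (h.tree_left.connected.dist_eq_zero_iff.1 (by omega)).symm
  have hc := h.tree_right.connected
  have hm : ∃ m, p m = m₁ ∧ q m = m₂ := by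
    have hr := mem_interval_or_mem_interval h.tree_right (h.swap.mem_interval_left hr) k1
    have hs := mem_interval_or_mem_interval h.tree_right (h.swap.mem_interval_left hs) k2
    have ht := mem_interval_or_mem_interval h.tree_right (h.swap.mem_interval_left ht) k3
    have b1 := fun a b ha hb => mem_interval_of_between hc k1 (s := a) (t := b) ha hb
    have b2 := fun a b ha hb => mem_interval_of_between hc k2 (s := a) (t := b) ha hb
    have b3 := fun a b ha hb => mem_interval_of_between hc k3 (s := a) (t := b) ha hb
    -- Seen from `m₂`, each of `r`, `s`, `t` lies towards one end of its own pair. No vertex is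
    -- common to the three pairs, so two of them lie towards different ends and `m₂` is between
    -- their second coordinates.
    rcases hr with hr | hr <;> rcases hs with hs | hs
    · exact key hr' hs' (b1 _ _ hr (mem_interval_symm hs))
    · exact key hs' hr' (b3 _ _ (mem_interval_symm hs) (mem_interval_symm hr))
    · rcases ht with ht | ht
      · exact key hs' ht' (b2 _ _ hs (mem_interval_symm ht))
      · exact key ht' hr' (b1 _ _ (mem_interval_symm ht) hr)
    · exact key hr' hs' (b2 _ _ (mem_interval_symm hr) hs)
  obtain ⟨m, hm1, hm2⟩ := hm
  have mem : ∀ {u v : V}, m₁ ∈ interval T₁ (p u) (p v) → m₂ ∈ interval T₂ (q u) (q v) →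
      m ∈ interval G u v := by
    intro u v a b
    rw [mem_interval] at *
    simp only [h.dist_eq, hm1, hm2]
    omega
  refine ⟨m, ⟨⟨mem h1 k1, mem h2 k2⟩, mem h3 k3⟩, ?_⟩
  rintro m' ⟨⟨l1, l2⟩, l3⟩
  refine h.ext hG ?_ ?_
  · rw [hm1]
    exact eq_of_mem_medians h.tree_left ⟨⟨h.mem_interval_left l1, h.mem_interval_left l2⟩,
      h.mem_interval_left l3⟩ ⟨⟨h1, h2⟩, h3⟩
  · rw [hm2]
    exact eq_of_mem_medians h.tree_right ⟨⟨h.swap.mem_interval_left l1,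
      h.swap.mem_interval_left l2⟩, h.swap.mem_interval_left l3⟩ ⟨⟨k1, k2⟩, k3⟩

end IsTreePair

end DoubleTrees

/-! ### Square colorings as 2-colorings of the link graph. -/

section SquareColorings

variable {V : Type*} {G : SimpleGraph V}

/-- A 2-coloring of the edges in which consecutive edges of squares have different colors. -/
def IsSquareColoring (G : SimpleGraph V) (c : Sym2 V → Bool) : Prop :=
  ∀ x y w z, IsSquare G x y w z → c s(x, y) ≠ c s(x, z)

theorem IsSquare.rotate {x y w z : V} (h : IsSquare G x y w z) : IsSquare G y w z x := by
  obtain ⟨h1, h2, h3, h4, h5, h6, h7, h8⟩ := h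
  exact ⟨h2, h3, h4, h1, h6, h5.symm, h8, fun h => h7 h.symm⟩

theorem IsSquareColoring.opposite {c : Sym2 V → Bool} (hc : IsSquareColoring G c) {x y w z : V}
    (h : IsSquare G x y w z) : c s(x, y) = c s(z, w) := by
  have h1 := hc _ _ _ _ h
  have h2 := hc _ _ _ _ h.flip.rotate
  rw [Sym2.eq_swap (a := z) (b := x)] at h2
  revert h1 h2
  cases c s(x, y) <;> cases c s(x, z) <;> cases c s(z, w) <;> simp

theorem linkGraph_adj_of_isSquare {x y w z : V} (h : IsSquare G x y w z) :
    (LinkGraph G).Adj ⟨s(x, y), h.1⟩ ⟨s(x, z), h.2.2.2.1.symm⟩ :=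
  ⟨x, ⟨h.1, by simp⟩, ⟨h.2.2.2.1.symm, by simp⟩, y, w, z, h, rfl, rfl⟩

theorem exists_isSquare_of_linkGraph_adj {e f : G.edgeSet} (h : (LinkGraph G).Adj e f) :
    ∃ x y w z, IsSquare G x y w z ∧ e.1 = s(x, y) ∧ f.1 = s(x, z) := by
  obtain ⟨x, he, hf, y, w, z, h, h1, h2⟩ := h
  exact ⟨x, y, w, z, h, h1, h2⟩

theorem linkGraph_isBipartite_iff :
    (LinkGraph G).IsBipartite ↔ ∃ c, IsSquareColoring G c := by
  classical
  constructor
  · rintro ⟨C⟩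
    -- The value off the edge set is arbitrary: squares involve edges only.
    refine ⟨fun e => if h : e ∈ G.edgeSet then decide (C ⟨e, h⟩ = 0) else false, ?_⟩
    intro x y w z h
    have h1 := C.valid (linkGraph_adj_of_isSquare h)
    have hy : s(x, y) ∈ G.edgeSet := h.1
    have hz : s(x, z) ∈ G.edgeSet := h.2.2.2.1.symm
    simp only [hy, hz, dite_true]
    intro h2
    rw [decide_eq_decide] at h2
    omega
  · rintro ⟨c, hc⟩
    let C : (LinkGraph G).Coloring Bool := Coloring.mk (fun e => c e.1) fun {e f} h => by
      obtain ⟨x, y, w, z, hs, he, hf⟩ := exists_isSquare_of_linkGraph_adj h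
      rw [he, hf]
      exact hc _ _ _ _ hs
    exact C.colorable

end SquareColorings

/-! ### The coloring of an embedding, and how it determines the embedding. -/

section EmbeddingColorings

variable {V W₁ W₂ : Type*} {G : SimpleGraph V} {T₁ : SimpleGraph W₁} {T₂ : SimpleGraph W₂}
  {p : V → W₁} {q : V → W₂}

open Classical in
/-- The edge coloring that records whether `p` separates the ends of an edge. -/
noncomputable def separationColor (p : V → W₁) (e : Sym2 V) : Bool :=
  decide (¬ (e.map p).IsDiag)

theorem separationColor_eq_true_iff {x y : V} : separationColor p s(x, y) = true ↔ p x ≠ p y := by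
  classical
  rw [separationColor, decide_eq_true_iff, Sym2.map_mk, Sym2.mk_isDiag_iff]

namespace IsTreePair

theorem eq_or_eq_of_adj (h : IsTreePair G T₁ T₂ p q) {x y : V} (hxy : G.Adj x y) :
    (p x = p y ∧ T₂.dist (q x) (q y) = 1) ∨ (q x = q y ∧ T₁.dist (p x) (p y) = 1) := by
  have e := h.dist_eq x y
  rw [dist_eq_one_iff_adj.2 hxy] at e
  have h1 := h.tree_left.connected.dist_eq_zero_iff (u := p x) (v := p y)
  have h2 := h.tree_right.connected.dist_eq_zero_iff (u := q x) (v := q y)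
  rw [← h1, ← h2]
  omega

theorem right_eq_iff_of_adj (h : IsTreePair G T₁ T₂ p q) {x y : V} (hxy : G.Adj x y) :
    q x = q y ↔ p x ≠ p y := by
  rcases h.eq_or_eq_of_adj hxy with ⟨h1, h2⟩ | ⟨h1, h2⟩
  · simp only [h1, ne_eq, not_true, iff_false]
    intro h3
    simp [h3] at h2
  · simp only [h1, true_iff]
    intro h3
    simp [h3] at h2

/-- Suppose `p` moves both `xy` and `xz`, so that `q` is constant on `x, y, z`. If `p` also moves
`yw`, then `p y` and `p z` are both midpoints of the geodesic from `p x` to `p w`; hence `y = z`. If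
not, `q` moves `yw`, and then `zw` cannot be accounted for. -/
theorem left_ne_of_isSquare (h : IsTreePair G T₁ T₂ p q) (hG : G.Connected) {x y w z : V}
    (hs : IsSquare G x y w z) (hy : p x ≠ p y) : p x = p z := by
  by_contra hz
  obtain ⟨a1, a2, a3, a4, a5, a6, a7, a8⟩ := hs
  have hqy := (h.right_eq_iff_of_adj a1).2 hy
  have hqz := (h.right_eq_iff_of_adj a4.symm).2 hz
  by_cases hw : p y = p w
  · by_cases hw' : p w = p z
    · exact a6 (h.ext hG (hw.trans hw') (hqy.symm.trans hqz))
    · have := (h.right_eq_iff_of_adj a3).2 hw'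
      have h2 := (h.right_eq_iff_of_adj a2).not_left.2 (by simpa using hw)
      exact h2 (hqy.symm.trans (hqz.trans this.symm))
  · have hqw := (h.right_eq_iff_of_adj a2).2 hw
    have hyw := h.dist_eq y w
    have hxw := h.dist_eq x w
    have hxy := h.dist_eq x y
    have hxz := h.dist_eq x z
    have hwz := h.dist_eq w z
    rw [← hqw, ← hqy, T₂.dist_self] at hxw
    rw [hqw, T₂.dist_self] at hyw
    rw [hqy, T₂.dist_self] at hxy
    rw [hqz, T₂.dist_self] at hxz
    rw [← hqw, ← hqy, ← hqz, T₂.dist_self] at hwz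
    rw [dist_eq_two hG a1 a2 a5 a7] at hxw
    rw [dist_eq_one_iff_adj.2 a1] at hxy
    rw [dist_eq_one_iff_adj.2 a2] at hyw
    rw [dist_eq_one_iff_adj.2 a3] at hwz
    rw [dist_eq_one_iff_adj.2 a4.symm] at hxz
    have e := T₁.dist_comm (u := p w) (v := p z)
    refine a6 (h.ext hG (eq_of_mem_interval h.tree_left (x := p x) (y := p w) ?_ ?_ ?_)
      (hqy.symm.trans hqz))
    · rw [mem_interval]; omega
    · rw [mem_interval]; omega
    · omega

/-- The edges moved by the first coordinate map form a color class of a square coloring. -/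
theorem isSquareColoring (h : IsTreePair G T₁ T₂ p q) (hG : G.Connected) :
    IsSquareColoring G (separationColor p) := by
  intro x y w z hs h'
  rw [Bool.eq_iff_iff, separationColor_eq_true_iff, separationColor_eq_true_iff] at h'
  by_cases hp : p x = p y
  · have h1 := h.swap.left_ne_of_isSquare hG hs
      (by simpa [h.right_eq_iff_of_adj hs.1] using hp)
    rw [h.right_eq_iff_of_adj hs.2.2.2.1.symm] at h1
    tauto
  · exact (h'.1 hp) (h.left_ne_of_isSquare hG hs hp)

/-- Along a geodesic of `G`, the last edge moves one coordinate only, the same one in both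
embeddings, and adds one to that distance because the two distances sum to the distance in `G`. -/
theorem dist_left_eq {W₁' W₂' : Type*} {S₁ : SimpleGraph W₁'} {S₂ : SimpleGraph W₂'} {p' : V → W₁'}
    {q' : V → W₂'} (h : IsTreePair G T₁ T₂ p q) (h' : IsTreePair G S₁ S₂ p' q') (hG : G.Connected)
    (H : ∀ x y, G.Adj x y → (p x = p y ↔ p' x = p' y)) (x y : V) :
    T₁.dist (p x) (p y) = S₁.dist (p' x) (p' y) := by
  induction hn : G.dist x y generalizing y with
  | zero =>
    obtain rfl := hG.dist_eq_zero_iff.1 hn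
    simp
  | succ n ih =>
    obtain ⟨z, hz, hd⟩ := exists_adj_dist_eq hG hn
    have ih := ih z hd
    by_cases hp : p z = p y
    · rwa [← hp, ← (H z y hz).1 hp]
    · have hq := (h.right_eq_iff_of_adj hz).2 hp
      have hq' := (h'.right_eq_iff_of_adj hz).2 ((H z y hz).not.1 hp)
      have e1 := h.dist_eq x y
      have e2 := h.dist_eq x z
      have e3 := h'.dist_eq x y
      have e4 := h'.dist_eq x z
      rw [hq] at e2
      rw [hq'] at e4
      omega

end IsTreePair

/-- Distances detect equality (0) and adjacency (1), so `p v ↦ p' v` is well defined and an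
isomorphism. -/
theorem exists_iso_of_dist_eq {V W W' : Type*} {T : SimpleGraph W} {S : SimpleGraph W'}
    (hT : T.Connected) (hS : S.Connected) {p : V → W} {p' : V → W'}
    (hp : Function.Surjective p) (hp' : Function.Surjective p')
    (h : ∀ x y, T.dist (p x) (p y) = S.dist (p' x) (p' y)) :
    ∃ α : T ≃g S, ∀ v, α (p v) = p' v := by
  have key : ∀ x y, p x = p y ↔ p' x = p' y := fun x y => by
    rw [← hT.dist_eq_zero_iff, ← hS.dist_eq_zero_iff, h]
  have hα : ∀ v, p' (Function.surjInv hp (p v)) = p' v := fun v =>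
    (key _ _).1 (Function.surjInv_eq hp _)
  refine ⟨⟨Equiv.ofBijective (fun w => p' (Function.surjInv hp w)) ⟨?_, ?_⟩, ?_⟩, hα⟩
  · intro a b hab
    obtain ⟨x, rfl⟩ := hp a
    obtain ⟨y, rfl⟩ := hp b
    simp only [hα] at hab
    exact (key _ _).2 hab
  · intro a
    obtain ⟨x, rfl⟩ := hp' a
    exact ⟨p x, hα x⟩
  · intro a b
    obtain ⟨x, rfl⟩ := hp a
    obtain ⟨y, rfl⟩ := hp b
    change S.Adj (p' (Function.surjInv hp (p x))) (p' (Function.surjInv hp (p y))) ↔ _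
    rw [hα, hα, ← dist_eq_one_iff_adj, ← dist_eq_one_iff_adj, h]

theorem isIsometricEmbedding_boxProd_iff (h₁ : T₁.IsTree) (h₂ : T₂.IsTree) {f : V → W₁ × W₂} :
    IsIsometricEmbedding G (T₁ □ T₂) f ↔
      IsTreePair G T₁ T₂ (fun v => (f v).1) (fun v => (f v).2) := by
  constructor
  · intro h
    exact ⟨h₁, h₂, fun x y => by rw [← h, dist_boxProd h₁.connected h₂.connected]⟩
  · intro h x y
    rw [dist_boxProd h₁.connected h₂.connected, h.dist_eq]

end EmbeddingColorings

/-! ### Halfspaces and ladders in median graphs. -/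

section MedianGraphs

variable {V : Type*} {G : SimpleGraph V}

/-- The median of `x, u, v` lies in `I(u, v) = {u, v}`. -/
theorem IsMedian.dist_eq_add_one_of_adj (hG : IsMedian G) (x : V) {u v : V} (h : G.Adj u v) :
    G.dist x u = G.dist x v + 1 ∨ G.dist x v = G.dist x u + 1 := by
  obtain ⟨m, ⟨⟨h1, h2⟩, h3⟩, -⟩ := hG.2 x u v
  rw [mem_interval] at *
  have e1 := dist_eq_one_iff_adj.2 h
  have e2 := hG.1.dist_eq_zero_iff (u := u) (v := m)
  have e3 := hG.1.dist_eq_zero_iff (u := m) (v := v)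
  have e4 := G.dist_comm (u := v) (v := x)
  have e5 := G.dist_comm (u := m) (v := x)
  have e6 := G.dist_comm (u := m) (v := u)
  have e7 := G.dist_comm (u := m) (v := v)
  omega

theorem IsMedian.dist_eq_add_one_of_adj' (hG : IsMedian G) (x : V) {u v : V} (h : G.Adj u v) :
    G.dist u x = G.dist v x + 1 ∨ G.dist v x = G.dist u x + 1 := by
  simpa only [G.dist_comm (v := x)] using hG.dist_eq_add_one_of_adj x h

/-- The quadrangle condition. -/
theorem IsMedian.exists_isSquare (hG : IsMedian G) {x u v w : V} (hv : G.Adj v u)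
    (hw : G.Adj w u) (hne : v ≠ w) (hdv : G.dist x u = G.dist x v + 1)
    (hdw : G.dist x u = G.dist x w + 1) :
    ∃ t, IsSquare G u v t w ∧ G.dist x v = G.dist x t + 1 := by
  have hvw : ¬ G.Adj v w := fun h => by
    have := hG.dist_eq_add_one_of_adj x h
    omega
  have h2 := dist_eq_two hG.1 hv hw.symm hne hvw
  obtain ⟨m, ⟨⟨h1, h2⟩, h3⟩, -⟩ := hG.2 x v w
  rw [mem_interval] at *
  have e4 := G.dist_comm (u := w) (v := x)
  have e5 := G.dist_comm (u := m) (v := x)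
  have e6 := G.dist_comm (u := m) (v := v)
  have e7 := G.dist_comm (u := m) (v := w)
  have hvm : G.Adj v m := dist_eq_one_iff_adj.1 (by omega)
  have hmw : G.Adj m w := dist_eq_one_iff_adj.1 (by omega)
  refine ⟨m, ⟨hv.symm, hvm, hmw, hw, ?_, hne, ?_, hvw⟩, by omega⟩
  · rintro rfl
    omega
  · intro h
    have := hG.dist_eq_add_one_of_adj x h
    omega

/-- The vertices that are closer to `x` than to `y`. -/
def half (G : SimpleGraph V) (x y : V) : Set V := {v | G.dist v x < G.dist v y}

theorem mem_half {x y v : V} : v ∈ half G x y ↔ G.dist v x < G.dist v y := Iff.rfl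

theorem left_mem_half {x y : V} (h : G.Adj x y) : x ∈ half G x y := by
  rw [mem_half, G.dist_self, dist_eq_one_iff_adj.2 h]
  exact one_pos

theorem right_notMem_half {x y : V} : y ∉ half G x y := by
  simp [mem_half]

theorem IsMedian.compl_half (hG : IsMedian G) {x y : V} (h : G.Adj x y) :
    (half G x y)ᶜ = half G y x := by
  ext v
  have := hG.dist_eq_add_one_of_adj v h
  rw [Set.mem_compl_iff, mem_half, mem_half]
  omega

/-- A vertex `v` nearer to `x` than `y` but nearer to `w` than `z` would make `x` and `w` two
medians of `v, y, z`. -/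
theorem IsMedian.half_subset_of_isSquare (hG : IsMedian G) {x y w z : V}
    (h : IsSquare G x y w z) : half G x y ⊆ half G z w := by
  obtain ⟨a1, a2, a3, a4, a5, a6, a7, a8⟩ := h
  intro v hv
  by_contra hv'
  rw [mem_half] at *
  have h1 := hG.dist_eq_add_one_of_adj v a1
  have h2 := hG.dist_eq_add_one_of_adj v a2
  have h3 := hG.dist_eq_add_one_of_adj v a3
  have h4 := hG.dist_eq_add_one_of_adj v a4
  have d1 := dist_eq_one_iff_adj.2 a1
  have d2 := dist_eq_one_iff_adj.2 a2
  have d3 := dist_eq_one_iff_adj.2 a3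
  have d4 := dist_eq_one_iff_adj.2 a4
  have d5 := dist_eq_two hG.1 a1.symm a4.symm a6 a8
  have e1 := G.dist_comm (u := x) (v := y)
  have e2 := G.dist_comm (u := x) (v := z)
  have e3 := G.dist_comm (u := w) (v := y)
  have e4 := G.dist_comm (u := w) (v := z)
  have e5 := G.dist_comm (u := v) (v := z)
  have e6 := G.dist_comm (u := v) (v := x)
  have e7 := G.dist_comm (u := v) (v := w)
  refine a5 ((hG.2 v y z).unique (y₁ := x) (y₂ := w) ⟨⟨?_, ?_⟩, ?_⟩ ⟨⟨?_, ?_⟩, ?_⟩) <;>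
    rw [mem_interval] <;> omega

theorem IsMedian.half_eq_of_isSquare (hG : IsMedian G) {x y w z : V}
    (h : IsSquare G x y w z) : half G x y = half G z w :=
  (hG.half_subset_of_isSquare h).antisymm (hG.half_subset_of_isSquare h.flip.rotate)

/-- All edges across a halfspace are joined by ladders of squares. -/
theorem IsMedian.ladder_induction (hG : IsMedian G) {x y : V} (hxy : G.Adj x y)
    {P : V → V → Prop} (h0 : P x y)
    (step : ∀ a b b' a', IsSquare G a b b' a' → P a b → P a' b') {u v : V} (huv : G.Adj u v)
    (hu : u ∈ half G x y) (hv : v ∉ half G x y) : P u v := by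
  rw [mem_half] at hu hv
  induction hn : G.dist x u generalizing u v with
  | zero =>
    obtain rfl := hG.1.dist_eq_zero_iff.1 hn
    have h1 := dist_eq_one_iff_adj.2 huv.symm
    have h2 := hG.dist_eq_add_one_of_adj v hxy
    obtain rfl := hG.1.dist_eq_zero_iff.1 (show G.dist v y = 0 by omega)
    exact h0
  | succ n ih =>
    obtain ⟨u', hu', hd⟩ := exists_adj_dist_eq hG.1 hn
    have e1 := G.dist_comm (u := x) (v := u)
    have e2 := G.dist_comm (u := x) (v := u')
    have e3 := G.dist_comm (u := y) (v := u)
    have e4 := G.dist_comm (u := y) (v := u')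
    have e5 := G.dist_comm (u := y) (v := v)
    have h1 := hG.dist_eq_add_one_of_adj v hxy
    have h2 := hG.dist_eq_add_one_of_adj u hxy
    have h3 := hG.dist_eq_add_one_of_adj u' hxy
    have h4 := hG.dist_eq_add_one_of_adj' x huv
    have h5 := hG.dist_eq_add_one_of_adj' y huv
    have h6 := hG.dist_eq_add_one_of_adj' y hu'
    -- Both `u'` and `v` are nearer to `y` than `u` is. The resulting square has the opposite side
    -- `u'v'`, which also crosses the halfspace and is one step nearer to `xy`.
    obtain ⟨v', hs, hd'⟩ := hG.exists_isSquare (x := y) hu' huv.symm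
      (by rintro rfl; omega) (by omega) (by omega)
    have h7 := hG.dist_eq_add_one_of_adj v' hxy
    have h8 := hG.dist_eq_add_one_of_adj' x hs.2.2.1
    have e6 := G.dist_comm (u := y) (v := v')
    exact step _ _ _ _ hs.rotate
      (ih hs.2.1 (by omega) (by omega) hd)

theorem IsMedian.half_eq_of_cross (hG : IsMedian G) {x y u v : V} (hxy : G.Adj x y)
    (huv : G.Adj u v) (hu : u ∈ half G x y) (hv : v ∉ half G x y) : half G u v = half G x y :=
  hG.ladder_induction (P := fun u v => half G u v = half G x y) hxy rfl
    (fun _ _ _ _ h h' => (hG.half_eq_of_isSquare h).symm.trans h') huv hu hv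

theorem exists_adj_cross (hG : G.Connected) {H : Set V} {u z : V} (hu : u ∈ H) (hz : z ∉ H) :
    ∃ a b, G.Adj a b ∧ a ∈ H ∧ b ∉ H ∧ G.dist u z = G.dist u a + 1 + G.dist b z := by
  induction hn : G.dist u z generalizing z with
  | zero =>
    obtain rfl := hG.dist_eq_zero_iff.1 hn
    exact absurd hu hz
  | succ n ih =>
    obtain ⟨z', hz', hd⟩ := exists_adj_dist_eq hG hn
    by_cases h : z' ∈ H
    · exact ⟨z', z, hz', h, hz, by simp [hd]⟩
    · obtain ⟨a, b, hab, ha, hb, hd'⟩ := ih h hd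
      refine ⟨a, b, hab, ha, hb, ?_⟩
      have h1 := dist_le_succ_of_adj hG b hz'
      have h2 := hG.dist_triangle (u := u) (v := a) (w := z)
      have h3 := hG.dist_triangle (u := a) (v := b) (w := z)
      rw [dist_eq_one_iff_adj.2 hab] at h3
      omega

/-- A geodesic leaving the half crosses an edge `ab` that defines the same half. Its endpoint `v` is
nearer to `a` than to `b`, so passing through `b` is a detour. -/
theorem IsMedian.isConvex_half (hG : IsMedian G) {x y : V} (hxy : G.Adj x y) :
    IsConvex G (half G x y) := by
  intro u hu v hv z hz
  by_contra hz'
  obtain ⟨a, b, hab, ha, hb, hd⟩ := exists_adj_cross hG.1 hu hz'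
  rw [← hG.half_eq_of_cross hxy hab ha hb, mem_half] at hv
  rw [mem_interval] at hz
  have h1 := hG.1.dist_triangle (u := u) (v := a) (w := v)
  have h2 := hG.1.dist_triangle (u := b) (v := z) (w := v)
  rw [G.dist_comm (u := v), G.dist_comm (u := v)] at hv
  omega

/-- A vertex of `H` nearer to `y` would have `y` on a geodesic to `x`, against convexity; likewise
for `Hᶜ`. -/
theorem IsMedian.eq_half (hG : IsMedian G) {H : Set V} (hH : IsConvex G H) (hH' : IsConvex G Hᶜ)
    {x y : V} (hxy : G.Adj x y) (hx : x ∈ H) (hy : y ∉ H) : H = half G x y := by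
  have h1 := dist_eq_one_iff_adj.2 hxy
  have h2 := dist_eq_one_iff_adj.2 hxy.symm
  ext v
  rw [mem_half]
  have h3 := hG.dist_eq_add_one_of_adj v hxy
  constructor
  · intro hv
    by_contra h
    exact hy (hH v hv x hx (by rw [mem_interval]; omega))
  · intro h
    by_contra hv
    exact hH' v hv y hy (show x ∈ _ by rw [mem_interval]; omega) hx

end MedianGraphs

/-! ### Comparing `Inc G` with the link graph. -/

section Splits

variable {V : Type*} {G : SimpleGraph V}

theorem IsMedian.isConvexSplit_half (hG : IsMedian G) {x y : V} (hxy : G.Adj x y) :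
    IsConvexSplit G {half G x y, half G y x} := by
  refine ⟨half G x y, ⟨x, left_mem_half hxy⟩, ⟨y, right_notMem_half⟩, hG.isConvex_half hxy, ?_, ?_⟩
  · rw [hG.compl_half hxy]
    exact hG.isConvex_half hxy.symm
  · rw [hG.compl_half hxy]

/-- The convex split that separates the ends of an edge. -/
def splitOf (hG : IsMedian G) (e : G.edgeSet) : {s : Set (Set V) // IsConvexSplit G s} :=
  ⟨Sym2.lift ⟨fun x y => {half G x y, half G y x}, fun _ _ => Set.pair_comm _ _⟩ e.1, by
    obtain ⟨e, he⟩ := e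
    induction e using Sym2.ind with
    | h x y => exact hG.isConvexSplit_half he⟩

theorem splitOf_mk (hG : IsMedian G) {x y : V} (hxy : G.Adj x y) :
    (splitOf hG ⟨s(x, y), hxy⟩).1 = {half G x y, half G y x} := rfl

theorem exists_splitOf_eq (hG : IsMedian G) {s : {s : Set (Set V) // IsConvexSplit G s}}
    {H : Set V} (hs : H ∈ s.1) {x y : V} (hxy : G.Adj x y) (hx : x ∈ H) (hy : y ∉ H) :
    splitOf hG ⟨s(x, y), hxy⟩ = s := by
  obtain ⟨s, K, h1, h2, h3, h4, rfl⟩ := s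
  apply Subtype.ext
  rw [splitOf_mk]
  rcases hs with rfl | rfl
  · rw [← hG.compl_half hxy, ← hG.eq_half h3 h4 hxy hx hy]
  · rw [← hG.compl_half hxy, ← hG.eq_half h4 (by rwa [compl_compl]) hxy hx hy, compl_compl,
      Set.pair_comm]

theorem splitOf_surjective (hG : IsMedian G) : Function.Surjective (splitOf hG) := by
  intro s
  obtain ⟨H, ⟨x, hx⟩, ⟨y, hy⟩, h3, h4, h5⟩ := s.2
  obtain ⟨a, b, hab, ha, hb, -⟩ := exists_adj_cross hG.1 hx hy
  exact ⟨_, exists_splitOf_eq hG (H := H) (by rw [h5]; simp) hab ha hb⟩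

/-- Edges with the same split are joined by a ladder, so whatever passes to opposite sides of
squares is shared by them. -/
theorem splitOf_induction (hG : IsMedian G) {P : Sym2 V → Prop}
    (step : ∀ a b b' a', IsSquare G a b b' a' → P s(a, b) → P s(a', b')) {e f : G.edgeSet}
    (h : splitOf hG e = splitOf hG f) (he : P e.1) : P f.1 := by
  obtain ⟨e, he'⟩ := e
  obtain ⟨f, hf'⟩ := f
  induction e using Sym2.ind with
  | h x y =>
    induction f using Sym2.ind with
    | h u v =>
      have key : ∀ {u v : V}, G.Adj u v → half G u v = half G x y → P s(u, v) := by
        intro u v huv h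
        refine hG.ladder_induction (P := fun u v => P s(u, v)) he' he step huv ?_ ?_
        · rw [← h]
          exact left_mem_half huv
        · rw [← h]
          exact right_notMem_half
      have h' : ({half G x y, half G y x} : Set (Set V)) = {half G u v, half G v u} :=
        congrArg Subtype.val h
      have hm : half G x y ∈ ({half G u v, half G v u} : Set (Set V)) := by
        rw [← h']
        simp
      rcases hm with hm | hm
      · exact key hf' hm.symm
      · have := key (u := v) (v := u) hf'.symm hm.symm
        rwa [Sym2.eq_swap] at this

/-- The four corners of the square witness the four intersections. -/
theorem splitOf_adj (hG : IsMedian G) {e f : G.edgeSet} (h : (LinkGraph G).Adj e f) :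
    (Inc G).Adj (splitOf hG e) (splitOf hG f) := by
  obtain ⟨e, he⟩ := e
  obtain ⟨f, hf⟩ := f
  obtain ⟨x, y, w, z, hs, h1, h2⟩ := exists_isSquare_of_linkGraph_adj h
  dsimp only at h1 h2
  subst h1 h2
  obtain ⟨a1, a2, a3, a4, a5, a6, a7, a8⟩ := hs
  have d1 := dist_eq_one_iff_adj.2 a1.symm
  have d2 := dist_eq_one_iff_adj.2 a2.symm
  have d3 := dist_eq_one_iff_adj.2 a3
  have d4 := dist_eq_one_iff_adj.2 a4
  have d5 := dist_eq_two hG.1 a1.symm a4.symm a6 a8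
  have d6 := dist_eq_two hG.1 a1 a2 a5 a7
  have e1 := G.dist_comm (u := y) (v := z)
  have e2 := G.dist_comm (u := x) (v := w)
  intro A hA B hB
  change A ∈ ({half G x y, half G y x} : Set (Set V)) at hA
  change B ∈ ({half G x z, half G z x} : Set (Set V)) at hB
  rcases hA with rfl | rfl <;> rcases hB with rfl | rfl
  · exact ⟨x, left_mem_half a1, left_mem_half a4.symm⟩
  · exact ⟨z, by rw [mem_half]; omega, left_mem_half a4⟩
  · exact ⟨y, left_mem_half a1.symm, by rw [mem_half]; omega⟩
  · exact ⟨w, by rw [mem_half]; omega, by rw [mem_half]; omega⟩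

/-- By convexity some edge crosses `H` inside `K` and another inside `Kᶜ`. The ladder joining them
must cross `K`, and the square where it does has consecutive sides with the two splits. -/
theorem exists_linkGraph_adj (hG : IsMedian G) {s t : {s : Set (Set V) // IsConvexSplit G s}}
    (h : (Inc G).Adj s t) :
    ∃ e f, splitOf hG e = s ∧ splitOf hG f = t ∧ (LinkGraph G).Adj e f := by
  obtain ⟨H, -, -, h3, h4, h5⟩ := s.2
  obtain ⟨K, -, -, k3, k4, k5⟩ := t.2
  have hH : H ∈ s.1 := by simp [h5]
  have hH' : Hᶜ ∈ s.1 := by simp [h5]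
  have hK : K ∈ t.1 := by simp [k5]
  have hK' : Kᶜ ∈ t.1 := by simp [k5]
  have key : ∀ L : Set V, IsConvex G L → (H ∩ L).Nonempty → (Hᶜ ∩ L).Nonempty →
      ∃ a b, G.Adj a b ∧ a ∈ H ∧ b ∉ H ∧ a ∈ L ∧ b ∈ L := by
    rintro L hL ⟨x, hx, hx'⟩ ⟨y, hy, hy'⟩
    obtain ⟨a, b, hab, ha, hb, hd⟩ := exists_adj_cross hG.1 hx hy
    have d := dist_eq_one_iff_adj.2 hab
    have e1 := hG.1.dist_triangle (u := x) (v := a) (w := b)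
    have e2 := hG.1.dist_triangle (u := a) (v := b) (w := y)
    have e3 := hG.1.dist_triangle (u := x) (v := a) (w := y)
    have e4 := hG.1.dist_triangle (u := x) (v := b) (w := y)
    exact ⟨a, b, hab, ha, hb, hL x hx' y hy' (by rw [mem_interval]; omega),
      hL x hx' y hy' (by rw [mem_interval]; omega)⟩
  obtain ⟨x, y, hxy, hx, hy, hx', hy'⟩ := key K k3 (h H hH K hK) (h Hᶜ hH' K hK)
  obtain ⟨u, v, huv, hu, hv, hu', hv'⟩ := key Kᶜ k4 (h H hH Kᶜ hK') (h Hᶜ hH' Kᶜ hK')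
  have hHxy := hG.eq_half h3 h4 hxy hx hy
  by_contra hcon
  have hind := hG.ladder_induction (P := fun a b => half G a b = H ∧ a ∈ K) hxy ⟨hHxy.symm, hx'⟩
    (fun a b b' a' hsq hP => by
      refine ⟨(hG.half_eq_of_isSquare hsq).symm.trans hP.1, ?_⟩
      by_contra ha'
      refine hcon ⟨_, _, ?_, ?_, linkGraph_adj_of_isSquare hsq⟩
      · exact exists_splitOf_eq hG hH hsq.1 (hP.1 ▸ left_mem_half hsq.1)
          (hP.1 ▸ right_notMem_half)
      · exact exists_splitOf_eq hG hK hsq.2.2.2.1.symm hP.2 ha') huv (hHxy ▸ hu) (hHxy ▸ hv)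
  exact hu' hind.2

/-- Opposite sides of a square are both adjacent in the link graph to a third side. -/
theorem linkGraph_reachable_of_splitOf_eq (hG : IsMedian G) {e f : G.edgeSet}
    (h : splitOf hG e = splitOf hG f) : (LinkGraph G).Reachable e f := by
  have := splitOf_induction hG (P := fun f' => ∃ hf : f' ∈ G.edgeSet,
    (LinkGraph G).Reachable e ⟨f', hf⟩) (fun a b b' a' hs ⟨_, hr⟩ => ?_) h ⟨e.2, Reachable.refl e⟩
  · exact this.2
  · refine ⟨hs.2.2.1.symm, hr.trans ((linkGraph_adj_of_isSquare hs).reachable.trans ?_)⟩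
    have h1 := (linkGraph_adj_of_isSquare hs.flip.rotate).symm.reachable
    simpa only [Sym2.eq_swap (a := a') (b := a)] using h1

theorem inc_connected_iff (hG : IsMedian G) : (Inc G).Connected ↔ (LinkGraph G).Connected := by
  constructor
  · intro h
    have key : ∀ s t, (Inc G).Reachable s t → ∀ e f, splitOf hG e = s → splitOf hG f = t →
        (LinkGraph G).Reachable e f := by
      rintro s t ⟨p⟩
      induction p with
      | nil => exact fun e f he hf => linkGraph_reachable_of_splitOf_eq hG (he.trans hf.symm)
      | cons hadj p ih =>
        intro e f he hf
        obtain ⟨e', f', he', hf', hadj'⟩ := exists_linkGraph_adj hG hadj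
        exact (linkGraph_reachable_of_splitOf_eq hG (he.trans he'.symm)).trans
          (hadj'.reachable.trans (ih f' f hf' hf))
    obtain ⟨s⟩ := h.nonempty
    obtain ⟨e, -⟩ := splitOf_surjective hG s
    have : Nonempty G.edgeSet := ⟨e⟩
    exact ⟨fun e f => key _ _ (h.preconnected _ _) e f rfl rfl⟩
  · intro h
    let φ : LinkGraph G →g Inc G := ⟨splitOf hG, fun h => splitOf_adj hG h⟩
    have : Nonempty {s : Set (Set V) // IsConvexSplit G s} := h.nonempty.map (splitOf hG)
    refine ⟨fun s t => ?_⟩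
    obtain ⟨e, rfl⟩ := splitOf_surjective hG s
    obtain ⟨f, rfl⟩ := splitOf_surjective hG t
    exact (h.preconnected e f).map φ

theorem inc_isBipartite_iff (hG : IsMedian G) : (Inc G).IsBipartite ↔ (LinkGraph G).IsBipartite := by
  constructor
  · rintro ⟨C⟩
    let φ : LinkGraph G →g Inc G := ⟨splitOf hG, fun h => splitOf_adj hG h⟩
    exact ⟨C.comp φ⟩
  · intro h
    obtain ⟨c, hc⟩ := linkGraph_isBipartite_iff.1 h
    have hfib : ∀ e f : G.edgeSet, splitOf hG e = splitOf hG f → c e.1 = c f.1 := fun e f h =>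
      splitOf_induction hG (P := fun f' => c e.1 = c f') (fun a b b' a' hs h' =>
        h'.trans (hc.opposite hs)) h rfl
    let C : (Inc G).Coloring Bool :=
      Coloring.mk (fun s => c (Function.surjInv (splitOf_surjective hG) s).1) fun {s t} hst => by
        obtain ⟨e, f, rfl, rfl, hadj⟩ := exists_linkGraph_adj hG hst
        rw [hfib _ e (Function.surjInv_eq _ _), hfib _ f (Function.surjInv_eq _ _)]
        obtain ⟨x, y, w, z, hs, he, hf⟩ := exists_isSquare_of_linkGraph_adj hadj
        rw [he, hf]
        exact hc _ _ _ _ hs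
    exact C.colorable

end Splits

/-! ### Contracting a color class to a tree. -/

section ColorTrees

variable {V : Type*} {G : SimpleGraph V}

/-- The edges of `G` whose color is not `i`. -/
def otherColors (G : SimpleGraph V) (c : Sym2 V → Bool) (i : Bool) : SimpleGraph V where
  Adj x y := G.Adj x y ∧ c s(x, y) ≠ i
  symm := ⟨fun x y h => ⟨h.1.symm, by rw [Sym2.eq_swap]; exact h.2⟩⟩
  loopless := ⟨fun _ h => h.1.ne rfl⟩

/-- The graph obtained from `G` by contracting all edges whose color is not `i`. -/
def colorTree (G : SimpleGraph V) (c : Sym2 V → Bool) (i : Bool) :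
    SimpleGraph (otherColors G c i).ConnectedComponent where
  Adj A B := A ≠ B ∧ ∃ x y, G.Adj x y ∧ (otherColors G c i).connectedComponentMk x = A ∧
    (otherColors G c i).connectedComponentMk y = B
  symm := ⟨fun _ _ ⟨h, x, y, hxy, hx, hy⟩ => ⟨h.symm, y, x, hxy.symm, hy, hx⟩⟩
  loopless := ⟨fun _ h => h.1 rfl⟩

/-- The projection of `G` to its contraction. -/
def colorClass (G : SimpleGraph V) (c : Sym2 V → Bool) (i : Bool) (x : V) :
    (otherColors G c i).ConnectedComponent :=
  (otherColors G c i).connectedComponentMk x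

variable {c : Sym2 V → Bool} {i : Bool}

theorem colorClass_surjective : Function.Surjective (colorClass G c i) :=
  fun A => A.exists_rep

theorem colorClass_eq_iff {x y : V} :
    colorClass G c i x = colorClass G c i y ↔ (otherColors G c i).Reachable x y :=
  ConnectedComponent.eq

theorem colorClass_eq_of_ne {x y : V} (hxy : G.Adj x y) (h : c s(x, y) ≠ i) :
    colorClass G c i x = colorClass G c i y :=
  colorClass_eq_iff.2 (Adj.reachable (G := otherColors G c i) ⟨hxy, h⟩)

theorem exists_adj_of_colorTree_adj {A B : (otherColors G c i).ConnectedComponent}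
    (h : (colorTree G c i).Adj A B) :
    ∃ x y, G.Adj x y ∧ c s(x, y) = i ∧ colorClass G c i x = A ∧ colorClass G c i y = B := by
  obtain ⟨hne, x, y, hxy, rfl, rfl⟩ := h
  refine ⟨x, y, hxy, ?_, rfl, rfl⟩
  by_contra hc
  exact hne (colorClass_eq_of_ne hxy hc)

theorem eq_color_of_cross (hG : IsMedian G) (hc : IsSquareColoring G c)
    {x y u v : V} (hxy : G.Adj x y) (huv : G.Adj u v)
    (hu : u ∈ half G x y) (hv : v ∉ half G x y) : c s(u, v) = c s(x, y) :=
  hG.ladder_induction (P := fun u v => c s(u, v) = c s(x, y)) hxy rfl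
    (fun _ _ _ _ h h' => (hc.opposite h).symm.trans h') huv hu hv

/-- All edges across the half have color `i`, so a walk through the other color never crosses it. -/
theorem mem_half_iff_of_colorClass_eq (hG : IsMedian G) (hc : IsSquareColoring G c)
    {x y u v : V} (hxy : G.Adj x y) (hi : c s(x, y) = i)
    (h : colorClass G c i u = colorClass G c i v) : u ∈ half G x y ↔ v ∈ half G x y := by
  obtain ⟨p⟩ := colorClass_eq_iff.1 h
  clear h
  induction p with
  | nil => rfl
  | @cons a b d hadj p ih =>
    rw [← ih]
    by_contra h
    by_cases ha : a ∈ half G x y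
    · exact hadj.2 ((eq_color_of_cross hG hc hxy hadj.1 ha (by tauto)).trans hi)
    · exact hadj.symm.2 ((eq_color_of_cross hG hc hxy hadj.1.symm (by tauto) ha).trans hi)

theorem colorClass_ne (hG : IsMedian G) (hc : IsSquareColoring G c)
    {x y : V} (hxy : G.Adj x y) (hi : c s(x, y) = i) :
    colorClass G c i x ≠ colorClass G c i y := fun h =>
  right_notMem_half ((mem_half_iff_of_colorClass_eq hG hc hxy hi h).1 (left_mem_half hxy))

theorem colorClass_ne_iff (hG : IsMedian G) (hc : IsSquareColoring G c)
    {x y : V} (hxy : G.Adj x y) :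
    colorClass G c i x ≠ colorClass G c i y ↔ c s(x, y) = i := by
  refine ⟨fun h => ?_, colorClass_ne hG hc hxy⟩
  by_contra h'
  exact h (colorClass_eq_of_ne hxy h')

theorem colorTree_adj (hG : IsMedian G) (hc : IsSquareColoring G c)
    {x y : V} (hxy : G.Adj x y) (hi : c s(x, y) = i) :
    (colorTree G c i).Adj (colorClass G c i x) (colorClass G c i y) :=
  ⟨colorClass_ne hG hc hxy hi, x, y, hxy, rfl, rfl⟩

/-- The rungs of a ladder have color `i`, so its rails have the other color and are contracted: all
crossing edges become one edge of the contraction. -/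
theorem colorClass_eq_of_cross (hG : IsMedian G) (hc : IsSquareColoring G c)
    {x y u v : V} (hxy : G.Adj x y) (hi : c s(x, y) = i)
    (huv : G.Adj u v) (hu : u ∈ half G x y) (hv : v ∉ half G x y) :
    colorClass G c i u = colorClass G c i x ∧ colorClass G c i v = colorClass G c i y := by
  refine (hG.ladder_induction (P := fun u v => c s(u, v) = i ∧
    colorClass G c i u = colorClass G c i x ∧ colorClass G c i v = colorClass G c i y) hxy
    ⟨hi, rfl, rfl⟩ ?_ huv hu hv).2
  rintro a b b' a' hs ⟨h1, h2, h3⟩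
  have h4 := hc _ _ _ _ hs
  have h5 := hc _ _ _ _ hs.rotate
  rw [Sym2.eq_swap (a := b) (b := a)] at h5
  refine ⟨(hc.opposite hs).symm.trans h1, ?_, ?_⟩
  · rw [← h2]
    exact (colorClass_eq_of_ne hs.2.2.2.1.symm (h1 ▸ h4.symm)).symm
  · rw [← h3]
    exact (colorClass_eq_of_ne hs.2.1 (h1 ▸ h5)).symm

/-- Every edge is a bridge: it is the only one between the classes inside a half and those outside.
-/
theorem colorTree_isTree (hG : IsMedian G) (hc : IsSquareColoring G c)
    (i : Bool) : (colorTree G c i).IsTree := by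
  obtain ⟨x₀⟩ := hG.1.nonempty
  have : Nonempty (otherColors G c i).ConnectedComponent := ⟨colorClass G c i x₀⟩
  refine ⟨⟨?_⟩, ?_⟩
  · have key : ∀ x y, G.Reachable x y →
        (colorTree G c i).Reachable (colorClass G c i x) (colorClass G c i y) := by
      rintro x y ⟨p⟩
      induction p with
      | nil => rfl
      | @cons a b d hadj p ih =>
        refine Reachable.trans ?_ ih
        by_cases hi : c s(a, b) = i
        · exact (colorTree_adj hG hc hadj hi).reachable
        · rw [colorClass_eq_of_ne hadj hi]
    intro A B
    obtain ⟨x, rfl⟩ := colorClass_surjective A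
    obtain ⟨y, rfl⟩ := colorClass_surjective B
    exact key x y (hG.1.preconnected x y)
  · rw [isAcyclic_iff_forall_adj_isBridge]
    intro A B hAB
    obtain ⟨x, y, hxy, hi, rfl, rfl⟩ := exists_adj_of_colorTree_adj hAB
    rw [isBridge_iff]
    rintro ⟨p⟩
    have key : ∀ A B, ((colorTree G c i).deleteEdges
        {s(colorClass G c i x, colorClass G c i y)}).Walk A B →
        (∀ u, colorClass G c i u = A → u ∈ half G x y) →
        ∀ u, colorClass G c i u = B → u ∈ half G x y := by
      intro A B p
      induction p with
      | nil => exact id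
      | @cons A B D hadj p ih =>
        intro hA
        refine ih fun v hv => ?_
        rw [deleteEdges_adj] at hadj
        obtain ⟨a, b, hab, -, rfl, rfl⟩ := exists_adj_of_colorTree_adj hadj.1
        rw [mem_half_iff_of_colorClass_eq hG hc hxy hi hv]
        by_contra hb
        obtain ⟨h1, h2⟩ := colorClass_eq_of_cross hG hc hxy hi hab (hA a rfl) hb
        exact hadj.2 (by rw [h1, h2]; rfl)
    exact right_notMem_half (key _ _ p (fun u hu =>
      (mem_half_iff_of_colorClass_eq hG hc hxy hi hu).2 (left_mem_half hxy)) y rfl)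

/-- A tree geodesic from the class of `x` to that of `y` leaves the half through its only crossing
edge, so it passes through the class of `z`. -/
theorem dist_colorClass (hG : IsMedian G) (hc : IsSquareColoring G c)
    {x y z : V} (hzy : G.Adj z y) (hi : c s(z, y) = i)
    (hd : G.dist x y = G.dist x z + 1) :
    (colorTree G c i).dist (colorClass G c i x) (colorClass G c i y) =
      (colorTree G c i).dist (colorClass G c i x) (colorClass G c i z) + 1 := by
  have hT := colorTree_isTree hG hc i
  have hx : x ∈ half G z y := by rw [mem_half]; omega
  obtain ⟨A, B, hAB, hA, hB, hd'⟩ := exists_adj_cross hT.connected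
    (H := {A | ∀ u, colorClass G c i u = A → u ∈ half G z y})
    (u := colorClass G c i x) (z := colorClass G c i y)
    (fun u hu => (mem_half_iff_of_colorClass_eq hG hc hzy hi hu).2 hx)
    (fun h => right_notMem_half (h y rfl))
  obtain ⟨a, b, hab, -, rfl, rfl⟩ := exists_adj_of_colorTree_adj hAB
  have hb : b ∉ half G z y := fun h => hB fun u hu =>
    (mem_half_iff_of_colorClass_eq hG hc hzy hi hu).2 h
  obtain ⟨h1, h2⟩ := colorClass_eq_of_cross hG hc hzy hi hab (hA a rfl) hb
  rw [h1, h2, SimpleGraph.dist_self] at hd'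
  omega

/-- The contractions of a median graph along the two classes of a square coloring form an
isometric embedding into a product of two trees. -/
theorem isTreePair_colorClass (hG : IsMedian G) (hc : IsSquareColoring G c) :
    IsTreePair G (colorTree G c true) (colorTree G c false)
    (colorClass G c true) (colorClass G c false) := by
  refine ⟨colorTree_isTree hG hc _, colorTree_isTree hG hc _, fun x y => ?_⟩
  induction hn : G.dist x y generalizing y with
  | zero =>
    obtain rfl := hG.1.dist_eq_zero_iff.1 hn
    simp
  | succ n ih =>
    obtain ⟨z, hz, hd⟩ := exists_adj_dist_eq hG.1 hn
    have ih := ih z hd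
    cases hi : c s(z, y) with
    | true =>
      rw [dist_colorClass hG hc hz hi (by omega),
        ← colorClass_eq_of_ne (i := false) hz (by simp [hi])]
      omega
    | false =>
      rw [dist_colorClass hG hc hz hi (by omega),
        ← colorClass_eq_of_ne (i := true) hz (by simp [hi])]
      omega

end ColorTrees

/-! ### Gluing colorings of the links. -/

section LinkColorings

variable {V : Type*} {G : SimpleGraph V}

/-- In a median graph, a `Bool`-valued 1-cocycle is a coboundary. -/
theorem IsMedian.exists_coboundary (hG : IsMedian G) (h : V → V → Bool)
    (hsymm : ∀ x y, h x y = h y x)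
    (hsq : ∀ x y w z, IsSquare G x y w z → ((h x y ^^ h y w) ^^ (h w z ^^ h z x)) = false) :
    ∃ ε : V → Bool, ∀ x y, G.Adj x y → ε y = (ε x ^^ h x y) := by
  classical
  obtain ⟨b⟩ := hG.1.nonempty
  -- Parents in a breadth-first tree rooted at `b`; the root is its own parent. Then `ε` sums `h`
  -- along the tree path from `b`.
  have hpar : ∀ x, ∃ z, ∀ n, G.dist b x = n + 1 → G.Adj z x ∧ G.dist b z = n := by
    intro x
    rcases hx : G.dist b x with _ | n
    · exact ⟨x, by simp⟩
    · obtain ⟨z, hz, hd⟩ := exists_adj_dist_eq hG.1 hx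
      refine ⟨z, fun m hm => ⟨hz, by omega⟩⟩
  choose par hpar using hpar
  let E : ℕ → V → Bool := fun n => Nat.rec (fun _ => false)
    (fun _ f x => f (par x) ^^ h (par x) x) n
  let ε : V → Bool := fun x => E (G.dist b x) x
  have hε : ∀ n x, G.dist b x = n + 1 → ε x = (ε (par x) ^^ h (par x) x) := by
    intro n x hx
    change E (G.dist b x) x = (E (G.dist b (par x)) (par x) ^^ _)
    rw [hx, (hpar x n hx).2]
  have key : ∀ n u v, G.Adj v u → G.dist b u = n + 1 → G.dist b v = n →
      ε u = (ε v ^^ h v u) := by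
    intro n
    induction n with
    | zero =>
      intro u v hvu hu hv
      obtain rfl := hG.1.dist_eq_zero_iff.1 hv
      have := hG.1.dist_eq_zero_iff.1 (hpar u 0 hu).2
      rw [hε 0 u hu, ← this]
    | succ n ih =>
      intro u v hvu hu hv
      obtain ⟨hp, hd⟩ := hpar u _ hu
      by_cases hne : v = par u
      · rw [hε _ u hu, ← hne]
      -- For two edges descending from `u`, the quadrangle condition supplies a square whose lower
      -- sides are covered by induction; the cocycle condition then compares the upper ones.
      obtain ⟨t, hs, ht⟩ := hG.exists_isSquare (x := b) hvu hp hne (by omega) (by omega)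
      have h1 := ih v t hs.2.1.symm hv (by omega)
      have h2 := ih (par u) t hs.2.2.1 hd (by omega)
      have h3 := hsq _ _ _ _ hs
      rw [hε _ u hu, h2, h1, hsymm v u, hsymm t v]
      revert h3
      cases h u v <;> cases h v t <;> cases h t (par u) <;> cases h (par u) u <;> simp
  refine ⟨ε, fun x y hxy => ?_⟩
  rcases hG.dist_eq_add_one_of_adj b hxy with hd | hd
  · have := key _ x y hxy.symm hd rfl
    rw [this, hsymm y x]
    simp
  · exact key _ y x hxy hd rfl

theorem link_isBipartite_of_isSquareColoring {c : Sym2 V → Bool} (hc : IsSquareColoring G c)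
    (x : V) : (Link G x).IsBipartite := by
  let C : (Link G x).Coloring Bool := Coloring.mk (fun e => c e.1) fun {e f} h => by
    obtain ⟨y, w, z, hs, he, hf⟩ := h
    rw [he, hf]
    exact hc _ _ _ _ hs
  exact C.colorable

/-- Colorings of the links of a median graph can be made to agree on common edges. -/
theorem exists_isSquareColoring_of_link (hG : IsMedian G)
    (h : ∀ x, (Link G x).IsBipartite) : ∃ c, IsSquareColoring G c := by
  classical
  have C := fun x => (h x).some
  let k : V → V → Bool := fun x y =>
    if h : G.Adj x y then decide (C x ⟨s(x, y), h, by simp⟩ = 0) else false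
  have hk : ∀ x y w z, IsSquare G x y w z → (k x y ^^ k x z) = true := by
    intro x y w z hs
    have hv := (C x).valid (v := ⟨s(x, y), hs.1, by simp⟩)
      (w := ⟨s(x, z), hs.2.2.2.1.symm, by simp⟩) ⟨y, w, z, hs, rfl, rfl⟩
    have hz := hs.2.2.2.1.symm
    simp only [k, hs.1, hz, dite_true, Bool.xor_iff_ne, ne_eq, decide_eq_decide]
    omega
  -- The cocycle records whether the links of `x` and `y` disagree on `xy`. Around a square the
  -- terms regroup by corners, each contributing `true`, and four of these cancel.
  obtain ⟨ε, hε⟩ := hG.exists_coboundary (fun x y => k x y ^^ k y x)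
    (fun x y => Bool.xor_comm _ _) fun x y w z hs => by
      have h1 := hk _ _ _ _ hs
      have h2 := hk _ _ _ _ hs.rotate
      have h3 := hk _ _ _ _ hs.rotate.rotate
      have h4 := hk _ _ _ _ hs.rotate.rotate.rotate
      revert h1 h2 h3 h4
      cases k x y <;> cases k x z <;> cases k y w <;> cases k y x <;> cases k w z <;>
        cases k w y <;> cases k z x <;> cases k z w <;> simp
  refine ⟨Sym2.lift ⟨fun x y => if G.Adj x y then k x y ^^ ε x else false,
    fun x y => ?_⟩, fun x y w z hs => ?_⟩
  · dsimp only
    by_cases hxy : G.Adj x y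
    · rw [if_pos hxy, if_pos hxy.symm, hε x y hxy]
      cases k x y <;> cases k y x <;> cases ε x <;> rfl
    · rw [if_neg hxy, if_neg fun h => hxy h.symm]
  · have := hk _ _ _ _ hs
    rw [Sym2.lift_mk, Sym2.lift_mk]
    simp only [if_pos hs.1, if_pos hs.2.2.2.1.symm]
    revert this
    cases k x y <;> cases k x z <;> cases ε x <;> simp

end LinkColorings

/-! ### Connected links, cut vertices and the connected link graph. -/

section LinkConnectivity

variable {V : Type*} {G : SimpleGraph V}

/-- The edge `xy` as a vertex of the link of `x`. -/
def linkVertex {x y : V} (h : G.Adj x y) : G.incidenceSet x := ⟨s(x, y), h, by simp⟩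

theorem linkVertex_surjective {x : V} (e : G.incidenceSet x) :
    ∃ (y : V) (h : G.Adj x y), e = linkVertex h := by
  obtain ⟨e, he, hx⟩ := e
  obtain ⟨y, rfl⟩ := hx
  exact ⟨y, he, rfl⟩

theorem link_adj_of_isSquare {x y w z : V} (h : IsSquare G x y w z) :
    (Link G x).Adj (linkVertex h.1) (linkVertex h.2.2.2.1.symm) :=
  ⟨y, w, z, h, rfl, rfl⟩

/-- The component of the link of `x` in which the geodesics from `x` to a given vertex start. -/
theorem IsMedian.exists_linkComponent (hG : IsMedian G) {x y₀ : V} (hy₀ : G.Adj x y₀) :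
    ∃ κ : V → (Link G x).ConnectedComponent,
      (∀ y (h : G.Adj x y), κ y = (Link G x).connectedComponentMk (linkVertex h)) ∧
      ∀ u v, G.Adj u v → u ≠ x → v ≠ x → κ u = κ v := by
  have hex : ∀ v, ∃ K : (Link G x).ConnectedComponent, ∀ y (h : G.Adj x y),
      G.dist v x = G.dist v y + 1 → K = (Link G x).connectedComponentMk (linkVertex h) := by
    intro v
    by_cases hv : ∃ y, G.Adj x y ∧ G.dist v x = G.dist v y + 1
    · obtain ⟨y, hy, hd⟩ := hv
      refine ⟨(Link G x).connectedComponentMk (linkVertex hy), fun z hz hd' => ?_⟩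
      by_cases hyz : y = z
      · subst hyz
        rfl
      obtain ⟨t, hs, -⟩ := hG.exists_isSquare hy.symm hz.symm hyz hd hd'
      exact ConnectedComponent.eq.2 (link_adj_of_isSquare hs).reachable
    -- This arises only for `v = x`, where the value does not matter.
    · exact ⟨(Link G x).connectedComponentMk (linkVertex hy₀), fun y hy hd =>
        absurd ⟨y, hy, hd⟩ hv⟩
  choose κ hκ using hex
  refine ⟨κ, fun y h => hκ y y h ?_, ?_⟩
  · rw [G.dist_self, dist_eq_one_iff_adj.2 h.symm]
  -- A first step of a geodesic from `x` to `u` also starts one to the farther vertex `v`.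
  · have key : ∀ u v, G.Adj u v → u ≠ x → G.dist x v = G.dist x u + 1 → κ u = κ v := by
      intro u v huv hu hd
      have hpos := hG.1.pos_dist_of_ne hu
      obtain ⟨y, hy, hdy⟩ := exists_adj_dist_eq hG.1
        (show G.dist u x = (G.dist u x - 1) + 1 by omega)
      rw [hκ u y hy.symm (by omega), hκ v y hy.symm]
      have h1 := hG.1.dist_triangle (u := v) (v := u) (w := y)
      have h2 := dist_eq_one_iff_adj.2 huv.symm
      have h3 := dist_le_succ_of_adj hG.1 v hy
      have h4 := G.dist_comm (u := v) (v := x)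
      have h5 := G.dist_comm (u := u) (v := x)
      omega
    intro u v huv hu hv
    rcases hG.dist_eq_add_one_of_adj x huv with hd | hd
    · exact (key v u huv.symm hv hd).symm
    · exact key u v huv hu hd

theorem exists_adj_of_nontrivial [Nontrivial V] (hG : G.Connected) (x : V) : ∃ y, G.Adj x y := by
  obtain ⟨y, hy⟩ := exists_ne x
  obtain ⟨a, b, hab, ha, -, -⟩ := exists_adj_cross hG (H := {x}) (u := x) (z := y) rfl hy
  obtain rfl : a = x := ha
  exact ⟨b, hab⟩

theorem link_connected_of_component_eq {x y₀ : V} (hy₀ : G.Adj x y₀)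
    {κ : V → (Link G x).ConnectedComponent}
    (h1 : ∀ y (h : G.Adj x y), κ y = (Link G x).connectedComponentMk (linkVertex h))
    (h2 : ∀ y z, G.Adj x y → G.Adj x z → κ y = κ z) : (Link G x).Connected := by
  have : Nonempty (G.incidenceSet x) := ⟨linkVertex hy₀⟩
  refine ⟨fun e f => ?_⟩
  obtain ⟨y, hy, rfl⟩ := linkVertex_surjective e
  obtain ⟨z, hz, rfl⟩ := linkVertex_surjective f
  rw [← ConnectedComponent.eq, ← h1, ← h1]
  exact h2 y z hy hz

theorem IsMedian.link_connected_of_induce [Nontrivial V] (hG : IsMedian G) {x : V}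
    (h : (G.induce {x}ᶜ).Connected) : (Link G x).Connected := by
  obtain ⟨y₀, hy₀⟩ := exists_adj_of_nontrivial hG.1 x
  obtain ⟨κ, h1, h2⟩ := hG.exists_linkComponent hy₀
  have key : ∀ u v, (G.induce {x}ᶜ).Walk u v → κ u.1 = κ v.1 := by
    intro u v p
    induction p with
    | nil => rfl
    | @cons a b d hadj p ih => exact (h2 a.1 b.1 hadj a.2 b.2).trans ih
  refine link_connected_of_component_eq hy₀ h1 fun y z hy hz => ?_
  obtain ⟨p⟩ := h.preconnected ⟨y, hy.ne'⟩ ⟨z, hz.ne'⟩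
  exact key _ _ p

theorem IsMedian.link_connected_of_linkGraph [Nontrivial V] (hG : IsMedian G)
    (h : (LinkGraph G).Connected) (x : V) : (Link G x).Connected := by
  obtain ⟨y₀, hy₀⟩ := exists_adj_of_nontrivial hG.1 x
  obtain ⟨κ, h1, h2⟩ := hG.exists_linkComponent hy₀
  -- The invariant along the link graph is the common value of `κ` at the ends of an edge other than
  -- `x`; at squares with corner `x` it persists because the two sides are adjacent in the link.
  have step : ∀ e f, (LinkGraph G).Adj e f → ∀ k, (∀ u ∈ e.1, u ≠ x → κ u = k) →
      ∀ v ∈ f.1, v ≠ x → κ v = k := by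
    intro e f hef k hk v hv hvx
    obtain ⟨a, b, w, d, hs, he, hf⟩ := exists_isSquare_of_linkGraph_adj hef
    rw [he] at hk
    rw [hf] at hv
    by_cases ha : a = x
    · subst ha
      obtain rfl : v = d := by
        rcases Sym2.mem_iff.1 hv with h | h
        · exact absurd h hvx
        · exact h
      rw [← hk b (by simp) hs.1.ne', h1 b hs.1, h1 v hs.2.2.2.1.symm]
      exact (ConnectedComponent.eq.2 (link_adj_of_isSquare hs).reachable).symm
    · rw [← hk a (by simp) ha]
      rcases Sym2.mem_iff.1 hv with rfl | rfl
      · rfl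
      · exact h2 _ _ hs.2.2.2.1 hvx ha
  have key : ∀ e f, (LinkGraph G).Walk e f → ∀ k, (∀ u ∈ e.1, u ≠ x → κ u = k) →
      ∀ v ∈ f.1, v ≠ x → κ v = k := by
    intro e f p
    induction p with
    | nil => exact fun _ h => h
    | cons hadj p ih => exact fun k hk => ih k (step _ _ hadj k hk)
  refine link_connected_of_component_eq hy₀ h1 fun y z hy hz => ?_
  obtain ⟨p⟩ := h.preconnected ⟨s(x, y), hy⟩ ⟨s(x, z), hz⟩
  refine (key _ _ p (κ y) (fun u hu hux => ?_) z (by simp) hz.ne').symm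
  rcases Sym2.mem_iff.1 hu with rfl | rfl
  · exact absurd rfl hux
  · rfl

theorem linkGraph_connected_of_link (hG : G.Connected) (h : ∀ x, (Link G x).Connected) :
    (LinkGraph G).Connected := by
  have hlink : ∀ x (e f : G.incidenceSet x),
      (LinkGraph G).Reachable ⟨e.1, e.2.1⟩ ⟨f.1, f.2.1⟩ := fun x e f =>
    ((h x).preconnected e f).map
      (⟨fun e => ⟨e.1, e.2.1⟩, fun {a b} hab => ⟨x, a.2, b.2, hab⟩⟩ : Link G x →g LinkGraph G)
  have key : ∀ u v, G.Walk u v → ∀ e f : G.edgeSet, u ∈ e.1 → v ∈ f.1 →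
      (LinkGraph G).Reachable e f := by
    intro u v p
    induction p with
    | nil => exact fun e f he hf => hlink _ ⟨e.1, e.2, he⟩ ⟨f.1, f.2, hf⟩
    | @cons a b d hadj p ih =>
      exact fun e f he hf => (hlink a ⟨e.1, e.2, he⟩ (linkVertex hadj)).trans
        (ih ⟨s(a, b), hadj⟩ f (by simp) hf)
  obtain ⟨x⟩ := hG.nonempty
  obtain ⟨e⟩ := (h x).nonempty
  have : Nonempty G.edgeSet := ⟨⟨e.1, e.2.1⟩⟩
  refine ⟨fun ⟨e, he⟩ ⟨f, hf⟩ => ?_⟩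
  induction e using Sym2.ind with
  | h a b =>
    induction f using Sym2.ind with
    | h u v =>
      obtain ⟨p⟩ := hG.preconnected a u
      exact key _ _ p _ _ (by simp) (by simp)

/-- A step in the link is replaced by the detour through the opposite corner of the square, which
avoids `x`; any other vertex reaches a neighbor of `x` along a geodesic. -/
theorem induce_connected_of_link [Nontrivial V] (hG : G.Connected) {x : V}
    (h : (Link G x).Connected) : (G.induce {x}ᶜ).Connected := by
  have key : ∀ e f, (Link G x).Walk e f → ∀ y z (hy : G.Adj x y) (hz : G.Adj x z),
      e = linkVertex hy → f = linkVertex hz →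
        (G.induce {x}ᶜ).Reachable ⟨y, hy.ne'⟩ ⟨z, hz.ne'⟩ := by
    intro e f p
    induction p with
    | nil =>
      rintro y z hy hz rfl hf
      obtain rfl := Sym2.congr_right.1 (congrArg Subtype.val hf)
      rfl
    | cons hadj p ih =>
      rintro y z hy hz rfl hf
      obtain ⟨y', w, z', hs, h1, h2⟩ := hadj
      obtain rfl := Sym2.congr_right.1 h1
      have hz' := hs.2.2.2.1.symm
      refine Reachable.trans ?_ (ih z' z hz' hz (Subtype.ext h2) hf)
      have a1 : (G.induce {x}ᶜ).Adj ⟨y, hy.ne'⟩ ⟨w, hs.2.2.2.2.1.symm⟩ := hs.2.1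
      have a2 : (G.induce {x}ᶜ).Adj ⟨w, hs.2.2.2.2.1.symm⟩ ⟨z', hz'.ne'⟩ := hs.2.2.1
      exact a1.reachable.trans a2.reachable
  have hnear : ∀ n v (hv : v ≠ x), G.dist x v = n + 1 →
      ∃ y, ∃ hy : G.Adj x y, (G.induce {x}ᶜ).Reachable ⟨v, hv⟩ ⟨y, hy.ne'⟩ := by
    intro n
    induction n with
    | zero => exact fun v hv hd => ⟨v, dist_eq_one_iff_adj.1 hd, Reachable.refl _⟩
    | succ n ih =>
      intro v hv hd
      obtain ⟨z, hz, hdz⟩ := exists_adj_dist_eq hG hd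
      have hzx : z ≠ x := by
        rintro rfl
        simp at hdz
      obtain ⟨y, hy, hr⟩ := ih z hzx hdz
      have a1 : (G.induce {x}ᶜ).Adj ⟨v, hv⟩ ⟨z, hzx⟩ := hz.symm
      exact ⟨y, hy, a1.reachable.trans hr⟩
  have hnear' : ∀ v (hv : v ≠ x), ∃ y, ∃ hy : G.Adj x y,
      (G.induce {x}ᶜ).Reachable ⟨v, hv⟩ ⟨y, hy.ne'⟩ := fun v hv =>
    hnear (G.dist x v - 1) v hv (by have := hG.pos_dist_of_ne hv.symm; omega)
  obtain ⟨y₀, hy₀⟩ := exists_ne x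
  have : Nonempty ({x}ᶜ : Set V) := ⟨⟨y₀, hy₀⟩⟩
  refine ⟨fun ⟨u, hu⟩ ⟨v, hv⟩ => ?_⟩
  obtain ⟨y, hy, hr⟩ := hnear' u hu
  obtain ⟨z, hz, hr'⟩ := hnear' v hv
  obtain ⟨p⟩ := h.preconnected (linkVertex hy) (linkVertex hz)
  exact hr.trans ((key _ _ p y z hy hz rfl rfl).trans hr'.symm)

end LinkConnectivity

/-! ### Uniqueness of the embedding and connectedness of the link graph. -/

section Uniqueness

variable {V : Type u} {G : SimpleGraph V}

theorem isPartialDoubleTree_iff : IsPartialDoubleTree G ↔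
    G.Connected ∧ ∃ (W₁ W₂ : Type u) (T₁ : SimpleGraph W₁) (T₂ : SimpleGraph W₂) (p : V → W₁)
      (q : V → W₂), IsTreePair G T₁ T₂ p q := by
  refine and_congr_right fun hG => ⟨?_, ?_⟩
  · rintro ⟨W₁, W₂, T₁, T₂, f, h₁, h₂, hf⟩
    exact ⟨W₁, W₂, T₁, T₂, _, _, (isIsometricEmbedding_boxProd_iff h₁ h₂).1 hf⟩
  · rintro ⟨W₁, W₂, T₁, T₂, p, q, h⟩
    exact ⟨W₁, W₂, T₁, T₂, fun v => (p v, q v), h.tree_left, h.tree_right,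
      (isIsometricEmbedding_boxProd_iff h.tree_left h.tree_right).2 h⟩

/-- Isometric subgraphs of products of two trees are median graphs. -/
theorem IsPartialDoubleTree.isMedian (h : IsPartialDoubleTree G) : IsMedian G := by
  obtain ⟨hG, _, _, _, _, _, _, h⟩ := isPartialDoubleTree_iff.1 h
  exact h.isMedian hG

theorem isPartialDoubleTree_iff_exists_isSquareColoring (hG : IsMedian G) :
    IsPartialDoubleTree G ↔ ∃ c, IsSquareColoring G c := by
  rw [isPartialDoubleTree_iff]
  constructor
  · rintro ⟨-, _, _, _, _, _, _, h⟩
    exact ⟨_, h.isSquareColoring hG.1⟩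
  · rintro ⟨c, hc⟩
    exact ⟨hG.1, _, _, _, _, _, _, isTreePair_colorClass hG hc⟩

theorem isMinimalEmbedding_colorClass (hG : IsMedian G) {c : Sym2 V → Bool}
    (hc : IsSquareColoring G c) :
    IsMinimalEmbedding G (colorTree G c true) (colorTree G c false)
      (fun v => (colorClass G c true v, colorClass G c false v)) :=
  ⟨colorTree_isTree hG hc _, colorTree_isTree hG hc _,
    (isIsometricEmbedding_boxProd_iff (colorTree_isTree hG hc _) (colorTree_isTree hG hc _)).2
      (isTreePair_colorClass hG hc), colorClass_surjective, colorClass_surjective⟩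

theorem IsMinimalEmbedding.isTreePair {W₁ W₂ : Type u} {T₁ : SimpleGraph W₁} {T₂ : SimpleGraph W₂}
    {f : V → W₁ × W₂} (h : IsMinimalEmbedding G T₁ T₂ f) :
    IsTreePair G T₁ T₂ (fun v => (f v).1) (fun v => (f v).2) :=
  (isIsometricEmbedding_boxProd_iff h.1 h.2.1).1 h.2.2.1

/-- Both colors switch at every step in the link graph, so their sum mod 2 is constant. -/
theorem eq_or_eq_not_of_linkGraph_connected (h : (LinkGraph G).Connected) {c c' : Sym2 V → Bool}
    (hc : IsSquareColoring G c) (hc' : IsSquareColoring G c') :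
    (∀ x y, G.Adj x y → c s(x, y) = c' s(x, y)) ∨
      ∀ x y, G.Adj x y → c s(x, y) = !c' s(x, y) := by
  have key : ∀ e f : G.edgeSet, (LinkGraph G).Reachable e f →
      (c e.1 ^^ c' e.1) = (c f.1 ^^ c' f.1) := by
    rintro e f ⟨p⟩
    induction p with
    | nil => rfl
    | cons hadj p ih =>
      rw [← ih]
      obtain ⟨x, y, w, z, hs, he, hf⟩ := exists_isSquare_of_linkGraph_adj hadj
      rw [he, hf]
      have h1 := hc _ _ _ _ hs
      have h2 := hc' _ _ _ _ hs
      revert h1 h2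
      cases c s(x, y) <;> cases c s(x, z) <;> cases c' s(x, y) <;> cases c' s(x, z) <;> simp
  obtain ⟨e⟩ := h.nonempty
  cases hb : (c e.1 ^^ c' e.1) with
  | false =>
    refine Or.inl fun x y hxy => ?_
    have := key e ⟨s(x, y), hxy⟩ (h.preconnected _ _)
    rw [hb] at this
    simpa using this.symm
  | true =>
    refine Or.inr fun x y hxy => ?_
    have := key e ⟨s(x, y), hxy⟩ (h.preconnected _ _)
    rw [hb] at this
    exact Bool.eq_not.2 (Bool.xor_iff_ne.1 this.symm)

theorem areEquivalent_of_left_eq_iff {W₁ W₂ W₁' W₂' : Type u} {T₁ : SimpleGraph W₁}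
    {T₂ : SimpleGraph W₂} {S₁ : SimpleGraph W₁'} {S₂ : SimpleGraph W₂'} (hG : G.Connected)
    {f : V → W₁ × W₂} {g : V → W₁' × W₂'} (hf : IsMinimalEmbedding G T₁ T₂ f)
    (hg : IsMinimalEmbedding G S₁ S₂ g)
    (h : ∀ x y, G.Adj x y → ((f x).1 = (f y).1 ↔ (g x).1 = (g y).1)) :
    ∃ (α : T₁ ≃g S₁) (β : T₂ ≃g S₂), ∀ v, g v = (α (f v).1, β (f v).2) := by
  have hf' := hf.isTreePair
  have hg' := hg.isTreePair
  obtain ⟨α, hα⟩ := exists_iso_of_dist_eq hf.1.connected hg.1.connected hf.2.2.2.1 hg.2.2.2.1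
    (hf'.dist_left_eq hg' hG h)
  obtain ⟨β, hβ⟩ := exists_iso_of_dist_eq hf.2.1.connected hg.2.1.connected hf.2.2.2.2 hg.2.2.2.2
    (hf'.swap.dist_left_eq hg'.swap hG fun x y hxy => by
      rw [hf'.right_eq_iff_of_adj hxy, hg'.right_eq_iff_of_adj hxy, ne_eq, ne_eq, h x y hxy])
  exact ⟨α, β, fun v => Prod.ext (hα v).symm (hβ v).symm⟩

theorem IsMinimalEmbedding.swap {W₁ W₂ : Type u} {T₁ : SimpleGraph W₁} {T₂ : SimpleGraph W₂}
    {f : V → W₁ × W₂} (h : IsMinimalEmbedding G T₁ T₂ f) :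
    IsMinimalEmbedding G T₂ T₁ (fun v => (f v).swap) :=
  ⟨h.2.1, h.1, (isIsometricEmbedding_boxProd_iff h.2.1 h.1).2 h.isTreePair.swap, h.2.2.2.2,
    h.2.2.2.1⟩

theorem hasUniqueEmbedding_of_linkGraph_connected (hG : G.Connected)
    (h : (LinkGraph G).Connected) : HasUniqueEmbedding G := by
  intro W₁ W₂ W₁' W₂' T₁ T₂ S₁ S₂ f g hf hg
  rcases eq_or_eq_not_of_linkGraph_connected h (hf.isTreePair.isSquareColoring hG)
    (hg.isTreePair.isSquareColoring hG) with hc | hc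
  · refine Or.inl (areEquivalent_of_left_eq_iff hG hf hg fun x y hxy => ?_)
    have := hc x y hxy
    rwa [Bool.eq_iff_iff, separationColor_eq_true_iff, separationColor_eq_true_iff,
      not_iff_not] at this
  · obtain ⟨α, β, hαβ⟩ := areEquivalent_of_left_eq_iff hG hf hg.swap fun x y hxy => by
      have := hc x y hxy
      rw [Bool.eq_iff_iff, Bool.not_eq_true', ← Bool.not_eq_true, separationColor_eq_true_iff,
        separationColor_eq_true_iff, not_iff_not] at this
      exact this.trans (hg.isTreePair.right_eq_iff_of_adj hxy).symm
    refine Or.inr ⟨α, β, fun v => ?_⟩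
    have := congrArg Prod.swap (hαβ v)
    simpa using this

/-- If the link graph is disconnected, interchanging the two colors on one of its components
yields an inequivalent embedding. -/
theorem linkGraph_connected_of_hasUniqueEmbedding [Nontrivial V] (hG : IsMedian G)
    {c : Sym2 V → Bool} (hc : IsSquareColoring G c) (h : HasUniqueEmbedding G) :
    (LinkGraph G).Connected := by
  classical
  obtain ⟨x₀⟩ := hG.1.nonempty
  obtain ⟨y₀, hxy₀⟩ := exists_adj_of_nontrivial hG.1 x₀
  have : Nonempty G.edgeSet := ⟨⟨s(x₀, y₀), hxy₀⟩⟩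
  refine ⟨fun e f => ?_⟩
  by_contra hef
  -- The component of `e`: the new coloring `c'` differs from `c` at `e` but not at `f`.
  let R : Sym2 V → Prop := fun d => ∃ hd : d ∈ G.edgeSet, (LinkGraph G).Reachable e ⟨d, hd⟩
  let c' : Sym2 V → Bool := fun d => c d ^^ decide (R d)
  have hc' : IsSquareColoring G c' := by
    intro x y w z hs
    have hadj := linkGraph_adj_of_isSquare hs
    have hR : R s(x, y) ↔ R s(x, z) :=
      ⟨fun ⟨_, hr⟩ => ⟨_, hr.trans hadj.reachable⟩,
        fun ⟨_, hr⟩ => ⟨_, hr.trans hadj.symm.reachable⟩⟩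
    simp only [c', hR]
    intro h'
    exact hc _ _ _ _ hs (Bool.xor_left_inj.1 h')
  have hce : c' e.1 = !c e.1 := by
    have : R e.1 := ⟨e.2, Reachable.refl _⟩
    simp [c', this]
  have hcf : c' f.1 = c f.1 := by
    have : ¬ R f.1 := fun ⟨_, hr⟩ => hef hr
    simp [c', this]
  -- An equivalence without interchange forces `c' = c` on all edges, refuted by `e`; one with
  -- interchange forces `c'` to be the complement of `c`, refuted by `f`.
  rcases h _ _ _ _ _ _ _ _ _ _ (isMinimalEmbedding_colorClass hG hc)
    (isMinimalEmbedding_colorClass hG hc') with ⟨α, β, hαβ⟩ | ⟨α, β, hαβ⟩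
  · have key : ∀ d : G.edgeSet, c' d.1 = c d.1 := by
      rintro ⟨d, hd⟩
      induction d using Sym2.ind with
      | h x y =>
        have h1 : ∀ v, colorClass G c' true v = α (colorClass G c true v) := fun v =>
          congrArg Prod.fst (hαβ v)
        rw [Bool.eq_iff_iff, ← colorClass_ne_iff hG hc hd, ← colorClass_ne_iff hG hc' hd, h1, h1,
          α.injective.ne_iff]
    have := key e
    rw [hce] at this
    simp at this
  · have key : ∀ d : G.edgeSet, c' d.1 = !c d.1 := by
      rintro ⟨d, hd⟩
      induction d using Sym2.ind with
      | h x y =>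
        have h1 : ∀ v, colorClass G c' true v = β (colorClass G c false v) := fun v =>
          congrArg Prod.fst (hαβ v)
        rw [Bool.eq_iff_iff, Bool.not_eq_true', ← colorClass_ne_iff hG hc hd,
          ← colorClass_ne_iff hG hc' hd, h1, h1, β.injective.ne_iff]
    have := key f
    rw [hcf] at this
    simp at this

end Uniqueness

end PartialDoubleTree

/-! ### The equivalence of the five conditions. -/

open PartialDoubleTree in
theorem corollary2 {V : Type*} (G : SimpleGraph V) (hG : G.Connected) (hV : 3 ≤ ENat.card V) :
    List.TFAE [
      PartialDoubleTree.IsPartialDoubleTree G ∧ PartialDoubleTree.HasUniqueEmbedding G,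
      PartialDoubleTree.IsTwoConnected G ∧ PartialDoubleTree.IsMedianSubgraphOfTwoTrees G,
      PartialDoubleTree.IsMedian G ∧
        (PartialDoubleTree.Inc G).IsBipartite ∧ (PartialDoubleTree.Inc G).Connected,
      PartialDoubleTree.IsMedian G ∧
        ∀ x : V, (PartialDoubleTree.Link G x).IsBipartite ∧ (PartialDoubleTree.Link G x).Connected,
      PartialDoubleTree.IsMedian G ∧
        (PartialDoubleTree.LinkGraph G).IsBipartite ∧ (PartialDoubleTree.LinkGraph G).Connected] := by
  have : Nontrivial V := by
    rw [← ENat.one_lt_card_iff_nontrivial]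
    exact lt_of_lt_of_le (by norm_num) hV
  tfae_have 1 ↔ 5 := by
    constructor
    · rintro ⟨h, hu⟩
      have hM := h.isMedian
      obtain ⟨c, hc⟩ := (isPartialDoubleTree_iff_exists_isSquareColoring hM).1 h
      exact ⟨hM, linkGraph_isBipartite_iff.2 ⟨c, hc⟩,
        linkGraph_connected_of_hasUniqueEmbedding hM hc hu⟩
    · rintro ⟨hM, hb, hc⟩
      exact ⟨(isPartialDoubleTree_iff_exists_isSquareColoring hM).2
        (linkGraph_isBipartite_iff.1 hb), hasUniqueEmbedding_of_linkGraph_connected hG hc⟩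
  tfae_have 3 ↔ 5 :=
    and_congr_right fun hM => and_congr (inc_isBipartite_iff hM) (inc_connected_iff hM)
  tfae_have 5 → 4 := by
    rintro ⟨hM, hb, hc⟩
    obtain ⟨c, hc'⟩ := linkGraph_isBipartite_iff.1 hb
    exact ⟨hM, fun x => ⟨link_isBipartite_of_isSquareColoring hc' x,
      hM.link_connected_of_linkGraph hc x⟩⟩
  tfae_have 4 → 5 := by
    rintro ⟨hM, h⟩
    exact ⟨hM, linkGraph_isBipartite_iff.2 (exists_isSquareColoring_of_link hM fun x => (h x).1),
      linkGraph_connected_of_link hG fun x => (h x).2⟩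
  tfae_have 2 → 4 := by
    rintro ⟨⟨-, -, h2⟩, hM, hT⟩
    obtain ⟨c, hc⟩ := (isPartialDoubleTree_iff_exists_isSquareColoring hM).1 ⟨hG, hT⟩
    exact ⟨hM, fun x => ⟨link_isBipartite_of_isSquareColoring hc x,
      hM.link_connected_of_induce (h2 x)⟩⟩
  tfae_have 4 → 2 := by
    rintro ⟨hM, h⟩
    exact ⟨⟨hV, hG, fun x => induce_connected_of_link hG (h x).2⟩, hM,
      ((isPartialDoubleTree_iff_exists_isSquareColoring hM).2
        (exists_isSquareColoring_of_link hM fun x => (h x).1)).2⟩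
  tfae_finish
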